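/- Let $V\ge 1$, $\eta>2$, $\lambda,R_\circ,w_t,L,T_s,W>0$, $0<\zeta\le 1$; let $f$ be a probability mass function on $\{1,\dots,V\}$, and for each $v$ let $w_v>0$, $\kappa_v\in[0,1]$, $\lambda_v=f(v)\lambda$. For $n\ge 1$ put $\mathcal R_n=\frac{L}{nT_s}$ and $\theta_n=2^{\mathcal R_n/(\zeta W)}-1$. Interfering devices are located at the points $x_1,x_2,\dots$ of a homogeneous Poisson point process on $\mathbb R^2$ of intensity $\lambda$. Device $i$ has a type $v_i\in\{1,\dots,V\}$; the types are i.i.d. with mass function $f$, independent of the locations. Let $\Psi=\{(x_i,v_i)\}$ be the marked point process. In a given time slot a device of type $v$ is active with probability $\kappa_v$, independently of everything except its type, and the fading gains $h_\circ,g_1,g_2,\dots$ are i.i.d. exponential with mean $1$, independent of locations, types and activities. The signal-to-interference ratio of a link of length $R_\circ$ with receiver at the origin is $$\mathrm{SIR}=\frac{w_t h_\circ R_\circ^{-\eta}}{\sum_{i:\ i\text{ active}} w_{v_i}g_i\|x_i\|^{-\eta}}.$$ Let $p_n=\mathbb P\{\mathrm{SIR}>\theta_n\mid\Psi\}$ be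 the transmission success probability at rate $\mathcal R_n$ and $\bar F_s(\theta_n,\gamma)=\mathbb P\{p_n>\gamma\}$ its meta distribution. Then the first two moments $\mu_n=\mathbb E[p_n]$ and $\nu_n=\mathbb E[p_n^2]$ are $$\mu_n=\exp\Big\{-\Upsilon\theta_n^{2/\eta}\sum_{v=1}^V\Big(\frac{w_v}{w_t}\Big)^{2/\eta}\kappa_v\lambda_v\Big\},$$ $$\nu_n=\exp\Big\{-\Upsilon\theta_n^{2/\eta}\sum_{v=1}^V\Big(\frac{w_v}{w_t}\Big)^{2/\eta}\kappa_v\lambda_v\Big(2-\Big(1-\frac2\eta\Big)\kappa_v\Big)\Big\},\qquad \Upsilon=\frac{2\pi^2R_\circ^2}{\eta\sin(2\pi/\eta)}.$$ Moreover, suppose $\kappa_v\lambda_v>0$ for some $v$, and put $$a=\frac{\mu_n(\mu_n-\nu_n)}{\nu_n-\mu_n^2},\qquad b=\frac{(1-\mu_n)(\mu_n-\nu_n)}{\nu_n-\mu_n^2}.$$ Then $a,b>0$, the beta distribution with parameters $(a,b)$ is the unique beta distribution whose first two moments are $\mu_n$ and $\nu_n$, and its complementary distribution function is $1-\mathcal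 I_\gamma(a,b)$ for $0\le\gamma\le1$, where $\mathcal I_\gamma(a,b)=\frac1{\mathcal B(a,b)}\int_0^\gamma t^{a-1}(1-t)^{b-1}\,dt$. Thus the approximation $\bar F_s(\theta_n,\gamma)\approx1-\mathcal I_\gamma(a,b)$ is the beta fit by matching of the first two moments; that is, $\int_0^1\bar F_s(\theta_n,\gamma)\,d\gamma=\int_0^1(1-\mathcal I_\gamma(a,b))\,d\gamma$ and $\int_0^1 2\gamma\bar F_s(\theta_n,\gamma)\,d\gamma=\int_0^1 2\gamma(1-\mathcal I_\gamma(a,b))\,d\gamma$. -/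

import Mathlib

open MeasureTheory ProbabilityTheory Set
open scoped ENNReal NNReal

noncomputable section

namespace IoT

/-- The Euclidean plane. -/
abbrev Plane : Type := EuclideanSpace ℝ (Fin 2)

/-- The random measure `N` is a Poisson point field with intensity measure `Λ`: the counts of
sets of finite intensity are Poisson distributed, and the counts of pairwise disjoint sets are
mutually independent. -/
structure IsPoissonPointField {Ω E : Type*} [MeasurableSpace Ω] [MeasurableSpace E]
    (P : Measure Ω) (N : Ω → Measure E) (Λ : Measure E) : Prop where
  measurable : Measurable N
  count_law : ∀ B : Set E, MeasurableSet B → Λ B ≠ ∞ →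
    P.map (fun ω => N ω B) =
      (poissonMeasure (Λ B).toNNReal).map (fun k : ℕ => (k : ℝ≥0∞))
  count_indep : ∀ (m : ℕ) (B : Fin m → Set E), (∀ j, MeasurableSet (B j)) →
    Pairwise (fun j k => Disjoint (B j) (B k)) →
    iIndepFun (fun j ω => N ω (B j)) P

/-- Deterministic parameters of the network with `V` types of interfering devices. -/
structure Params (V : ℕ) where
  /-- transmit power `w_t` of the intended transmitter -/
  wt : ℝ
  wt_pos : 0 < wt
  /-- length `R_∘` of the intended link -/
  R₀ : ℝ
  R₀_pos : 0 < R₀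
  /-- path-loss exponent -/
  η : ℝ
  two_lt_η : 2 < η
  /-- intensity of all interfering devices -/
  lam : ℝ
  lam_pos : 0 < lam
  /-- probability mass function of the type of an interfering device -/
  f : PMF (Fin V)
  /-- transmit powers of the interfering devices, by type -/
  w : Fin V → ℝ
  w_pos : ∀ v, 0 < w v
  /-- activity factors of the interfering devices, by type -/
  κ : Fin V → ℝ
  κ_nonneg : ∀ v, 0 ≤ κ v
  κ_le_one : ∀ v, κ v ≤ 1
  /-- packet size in bits -/
  L : ℝ
  L_pos : 0 < L
  /-- slot duration -/
  Ts : ℝ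
  Ts_pos : 0 < Ts
  /-- bandwidth -/
  W : ℝ
  W_pos : 0 < W
  /-- fraction of the Shannon capacity that is achieved -/
  ζ : ℝ
  ζ_pos : 0 < ζ
  ζ_le_one : ζ ≤ 1

namespace Params

variable {V : ℕ} (p : Params V)

/-- Intensity `λ_v` of the devices of type `v`. -/
def intensity (v : Fin V) : ℝ := (p.f v).toReal * p.lam

/-- Transmission rate `𝓡_n = L / (n T_s)`. -/
def rate (n : ℕ) : ℝ := p.L / (n * p.Ts)

/-- Decoding threshold `θ_n`, the solution of `𝓡_n = ζ W log₂ (1 + θ_n)`. -/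
def threshold (n : ℕ) : ℝ := (2 : ℝ) ^ (p.rate n / (p.ζ * p.W)) - 1

/-- `Υ = 2 π² R_∘² / (η sin (2 π / η))`. -/
def Upsilon : ℝ :=
  2 * Real.pi ^ 2 * p.R₀ ^ 2 / (p.η * Real.sin (2 * Real.pi / p.η))

end Params

/-- The random elements of the network in one time slot, seen from the intended receiver, which is
at the origin; `i : ℕ` enumerates the interfering devices. -/
structure Network (V : ℕ) (Ω : Type*) where
  /-- locations of the interfering devices -/
  x : ℕ → Ω → Plane
  /-- types of the interfering devices -/
  mark : ℕ → Ω → Fin V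
  /-- whether the interfering devices are active in the slot -/
  active : ℕ → Ω → Bool
  /-- channel gains of the interfering devices -/
  g : ℕ → Ω → ℝ
  /-- channel gain of the intended link -/
  h : Ω → ℝ

namespace Network

variable {V : ℕ} {Ω : Type*} (S : Network V Ω)

/-- Counting measure of the device locations. -/
def locations (ω : Ω) : Measure Plane :=
  Measure.sum fun i => Measure.dirac (S.x i ω)

/-- Counting measure of the marked device locations: the heterogeneous Poisson field `Ψ`. -/
def field (ω : Ω) : Measure (Plane × Fin V) :=
  Measure.sum fun i => Measure.dirac (S.x i ω, S.mark i ω)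

/-- The joint law of the network: locations form a homogeneous Poisson point field of intensity
`lam`; types are i.i.d. with mass function `f`; a device of type `v` is active with probability
`κ v`; all channel gains are exponential with unit mean. The sequence of locations, the
gain of the intended link, the (type, activity) pairs of the devices and the gains of the devices
are mutually independent. -/
structure IsHPF [MeasurableSpace Ω] (P : Measure Ω) (p : Params V) : Prop where
  measurable_x : ∀ i, Measurable (S.x i)
  measurable_mark : ∀ i, Measurable (S.mark i)
  measurable_active : ∀ i, Measurable (S.active i)
  measurable_g : ∀ i, Measurable (S.g i)
  measurable_h : Measurable S.h
  poisson : IsPoissonPointField P S.locations (ENNReal.ofReal p.lam • volume)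
  mark_law : ∀ i v, P {ω | S.mark i ω = v} = p.f v
  active_law : ∀ i v, P {ω | S.mark i ω = v ∧ S.active i ω = true} =
    p.f v * ENNReal.ofReal (p.κ v)
  g_law : ∀ i, P.map (S.g i) = expMeasure 1
  h_law : P.map S.h = expMeasure 1
  indep_gain : ∀ i, IndepFun (fun ω => (S.mark i ω, S.active i ω)) (S.g i) P
  indep_devices : iIndepFun (fun i ω => ((S.mark i ω, S.active i ω), S.g i ω)) P
  indep_h : IndepFun S.h (fun ω i => ((S.mark i ω, S.active i ω), S.g i ω)) P
  indep_x : IndepFun (fun ω i => S.x i ω)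
    (fun ω => (S.h ω, fun i => ((S.mark i ω, S.active i ω), S.g i ω))) P

/-- Received interference power: the sum of `w_v g_i ‖x_i‖ ^ (-η)` over the active devices. -/
def interference (p : Params V) (ω : Ω) : ℝ≥0∞ :=
  ∑' i, if S.active i ω = true then
    ENNReal.ofReal (p.w (S.mark i ω) * S.g i ω) * ‖S.x i ω‖ₑ ^ (-p.η) else 0

/-- Signal-to-interference ratio (infinite if the signal is positive and nobody interferes). -/
def sir (p : Params V) (ω : Ω) : ℝ≥0∞ :=
  ENNReal.ofReal (p.wt * S.h ω * p.R₀ ^ (-p.η)) / S.interference p ω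

/-- Transmission success probability at rate `𝓡_n`: the conditional probability of
`SIR > θ_n` given the heterogeneous Poisson field. -/
def tsp [MeasurableSpace Ω] (P : Measure Ω) (p : Params V) (n : ℕ) : Ω → ℝ :=
  P⟦{ω | ENNReal.ofReal (p.threshold n) < S.sir p ω} |
    MeasurableSpace.comap S.field inferInstance⟧

/-- Meta distribution of the transmission success probability. -/
def metaDistribution [MeasurableSpace Ω] (P : Measure Ω) (p : Params V) (n : ℕ) (γ : ℝ) : ℝ :=
  P.real {ω | γ < S.tsp P p n ω}

end Network

/-- Regularized incomplete beta function `I_γ(a, b)`. -/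
def regIncBeta (a b γ : ℝ) : ℝ :=
  1 / beta a b * ∫ t in (0 : ℝ)..γ, t ^ (a - 1) * (1 - t) ^ (b - 1)

end IoT

end

-- Exponentials on `[0, ∞]` and the Poisson Laplace transform.

namespace IoT

open Filter Topology

-- The event `SIR > θ_n` says that the exponential gain `h` exceeds the normalized interference, so
-- integrating out `h` gives `exp (-interference)`. This is a product over devices. Integrating out
-- activity and fading, given locations and types, replaces each factor by `survival`, which away
-- from the origin is `1 - κ_v y_v(x)` with `y_v(x) = c_v / (‖x‖^η + c_v)` and `c_v = halfGain`.
-- Hence `p_n` is the product of these factors over the marked field (`tsp_ae_eq`).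
--
-- Moments of such a product are Laplace functionals of the marked field. Averaging over the types
-- leaves a functional of the Poisson locations alone, evaluated by `lintegral_negExp_lintegral`.
-- The exponents are therefore `λ_v` times the plane integrals of `1 - (1 - κ_v y_v) = κ_v y_v` for
-- the mean and `1 - (1 - κ_v y_v)² = 2 κ_v y_v - κ_v² y_v²` for the second moment. Gamma integrals
-- and Euler reflection give both; the second power of `y_v` brings in the factor `1 - 2/η`.
--
-- Comparing exponents term by term yields `μ² < ν < μ`, which is exactly what makes the moment
-- equations of a beta law solvable, uniquely. The layer cake formula turns equality of moments into
-- equality of the integrals of the tail functions.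
--
-- Products are handled in `[0, ∞]` as `negExp` of sums of `negLog`, so that vanishing factors and
-- divergent sums need no separate treatment.

/-- The function `t ↦ exp (-t)` on `[0, ∞]`, with `exp (-∞) = 0`. -/
noncomputable def negExp (t : ℝ≥0∞) : ℝ≥0∞ := (EReal.exp t)⁻¹

@[simp] lemma negExp_zero : negExp 0 = 1 := by simp [negExp]

@[simp] lemma negExp_top : negExp ∞ = 0 := by simp [negExp]

lemma negExp_antitone : Antitone negExp := fun s t h => by
  unfold negExp
  gcongr
  exact_mod_cast h

lemma negExp_le_one (t : ℝ≥0∞) : negExp t ≤ 1 := by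
  simpa using negExp_antitone (zero_le : 0 ≤ t)

lemma negExp_ne_top (t : ℝ≥0∞) : negExp t ≠ ∞ :=
  ne_top_of_le_ne_top ENNReal.one_ne_top (negExp_le_one t)

lemma continuous_negExp : Continuous negExp :=
  (ENNReal.continuous_exp.comp continuous_coe_ennreal_ereal).inv

@[fun_prop]
lemma measurable_negExp : Measurable negExp := continuous_negExp.measurable

lemma negExp_ofReal {r : ℝ} (hr : 0 ≤ r) :
    negExp (ENNReal.ofReal r) = ENNReal.ofReal (Real.exp (-r)) := by
  rw [negExp, EReal.coe_ennreal_ofReal, max_eq_left hr, EReal.exp_coe, Real.exp_neg,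
    ENNReal.ofReal_inv_of_pos (Real.exp_pos _)]

lemma negExp_add (s t : ℝ≥0∞) : negExp (s + t) = negExp s * negExp t := by
  have h (u : ℝ≥0∞) : EReal.exp u ≠ 0 := by
    simp
  rw [negExp, EReal.coe_ennreal_add, EReal.exp_add,
    ENNReal.mul_inv (.inl (h s)) (.inr (h t)), negExp, negExp]

lemma negExp_sum {ι : Type*} (s : Finset ι) (a : ι → ℝ≥0∞) :
    negExp (∑ i ∈ s, a i) = ∏ i ∈ s, negExp (a i) := by
  classical
  induction s using Finset.induction_on with
  | empty => simp
  | insert i s hi ih => rw [Finset.sum_insert hi, Finset.prod_insert hi, negExp_add, ih]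

lemma negExp_natCast_mul (k : ℕ) (t : ℝ≥0∞) : negExp (k * t) = negExp t ^ k := by
  simpa using negExp_sum (Finset.range k) (fun _ => t)

lemma tendsto_prod_negExp (a : ℕ → ℝ≥0∞) :
    Tendsto (fun n => ∏ i ∈ Finset.range n, negExp (a i)) atTop (𝓝 (negExp (∑' i, a i))) := by
  simp_rw [← negExp_sum]
  exact (continuous_negExp.tendsto _).comp ENNReal.summable.hasSum.tendsto_sum_nat

/-- The function `q ↦ -log q` on `[0, 1]`, with `-log 0 = ∞`. -/
noncomputable def negLog (q : ℝ≥0∞) : ℝ≥0∞ := (-ENNReal.log q).toENNReal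

@[fun_prop]
lemma measurable_negLog : Measurable negLog :=
  measurable_ereal_toENNReal.comp (ENNReal.measurable_log.neg)

/-- The bound is needed because `toENNReal` truncates the negative value `-log q` to `0` when `q >
1`. -/
lemma negExp_negLog {q : ℝ≥0∞} (hq : q ≤ 1) : negExp (negLog q) = q := by
  rw [negExp, negLog, EReal.coe_toENNReal, EReal.exp_neg, ENNReal.exp_log, inv_inv]
  rw [EReal.le_neg]
  simpa using hq

/-- Bounded convergence for `negExp`. -/
lemma tendsto_lintegral_negExp {Ω : Type*} [MeasurableSpace Ω] {P : Measure Ω}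
    [IsFiniteMeasure P] {X : ℕ → Ω → ℝ≥0∞} {Y : Ω → ℝ≥0∞} (hX : ∀ n, Measurable (X n))
    (h : ∀ ω, Tendsto (fun n => X n ω) atTop (𝓝 (Y ω))) :
    Tendsto (fun n => ∫⁻ ω, negExp (X n ω) ∂P) atTop (𝓝 (∫⁻ ω, negExp (Y ω) ∂P)) := by
  refine tendsto_lintegral_of_dominated_convergence (fun _ => 1)
    (fun n => measurable_negExp.comp (hX n)) (fun n => .of_forall fun ω => negExp_le_one _)
    (by simp) (.of_forall fun ω => (continuous_negExp.tendsto _).comp (h ω))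

/-- Laplace transform of the Poisson distribution. -/
lemma lintegral_negExp_mul_poissonMeasure (r : ℝ≥0) (c : ℝ≥0∞) :
    ∫⁻ k : ℕ, negExp (c * k) ∂(poissonMeasure r) = negExp ((1 - negExp c) * r) := by
  obtain ⟨q, hq⟩ : ∃ q : ℝ≥0, negExp c = q := ⟨_, (ENNReal.coe_toNNReal (negExp_ne_top c)).symm⟩
  have hq1 : q ≤ 1 := by
    have := negExp_le_one c
    rw [hq] at this
    exact_mod_cast this
  have hsum : HasSum (fun k : ℕ => Real.exp (-r) * ((r * q : ℝ) ^ k / k.factorial))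
      (Real.exp (-r) * Real.exp (r * q)) := by
    rw [Real.exp_eq_exp_ℝ]
    exact (NormedSpace.expSeries_div_hasSum_exp (r * q : ℝ)).mul_left _
  have hrhs : (1 - negExp c) * r = ENNReal.ofReal ((1 - (q : ℝ)) * (r : ℝ)) := by
    rw [hq, ENNReal.ofReal_mul (by simpa using hq1), ENNReal.ofReal_sub _ q.coe_nonneg]
    simp
  rw [lintegral_countable', hrhs, negExp_ofReal (mul_nonneg (by simpa using hq1) r.coe_nonneg)]
  have : Real.exp (-((1 - q : ℝ) * r)) = Real.exp (-r) * Real.exp (r * q) := by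
    rw [← Real.exp_add]; ring_nf
  rw [this, ← hsum.tsum_eq, ENNReal.ofReal_tsum_of_nonneg (fun k => by positivity) hsum.summable]
  congr 1 with k
  rw [poissonMeasure_singleton, mul_comm c, negExp_natCast_mul, hq, ← ENNReal.coe_pow,
    ← ENNReal.ofReal_coe_nnreal, ← ENNReal.ofReal_mul (by positivity)]
  congr 1
  push_cast
  ring

-- Laplace functional of a Poisson point field.

namespace IsPoissonPointField

variable {Ω E : Type*} [MeasurableSpace Ω] [MeasurableSpace E] {P : Measure Ω}
  {N : Ω → Measure E} {Λ : Measure E}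

lemma measurable_apply (h : IsPoissonPointField P N Λ) {B : Set E} (hB : MeasurableSet B) :
    Measurable fun ω => N ω B :=
  (Measure.measurable_coe hB).comp h.measurable

lemma lintegral_negExp_mul_count (h : IsPoissonPointField P N Λ) {B : Set E}
    (hB : MeasurableSet B) (hΛ : Λ B ≠ ∞) (c : ℝ≥0∞) :
    ∫⁻ ω, negExp (c * N ω B) ∂P = negExp ((1 - negExp c) * Λ B) := by
  have hm : Measurable fun x : ℝ≥0∞ => negExp (c * x) := by fun_prop
  rw [← lintegral_map (f := fun x => negExp (c * x)) hm (h.measurable_apply hB),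
    h.count_law B hB hΛ, lintegral_map hm (by fun_prop), lintegral_negExp_mul_poissonMeasure,
    ENNReal.coe_toNNReal hΛ]

lemma iIndepFun_count (h : IsPoissonPointField P N Λ) {ι : Type*} [Fintype ι] {B : ι → Set E}
    (hB : ∀ i, MeasurableSet (B i)) (hd : Pairwise fun i j => Disjoint (B i) (B j)) :
    iIndepFun (fun i ω => N ω (B i)) P := by
  let e := Fintype.equivFin ι
  have := h.count_indep _ (fun j => B (e.symm j)) (fun j => hB _)
    (fun i j hij => hd (e.symm.injective.ne hij))
  simpa using this.precomp e.injective

/-- The level sets are disjoint, so their counts are independent Poisson variables and the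
expectation factors into one-dimensional Laplace transforms. -/
lemma lintegral_negExp_simpleFunc (h : IsPoissonPointField P N Λ) (s : SimpleFunc E ℝ≥0∞)
    (hs : s.FinMeasSupp Λ) :
    ∫⁻ ω, negExp (∫⁻ x, s x ∂N ω) ∂P = negExp (∫⁻ x, (1 - negExp (s x)) ∂Λ) := by
  classical
  -- The level `0` is dropped: its level set may have infinite intensity, and it contributes nothing
  -- to either side.
  let R := s.range.filter (· ≠ 0)
  have hsum (M : Measure E) (φ : ℝ≥0∞ → ℝ≥0∞) (hφ : φ 0 = 0) :
      ∫⁻ x, φ (s x) ∂M = ∑ y : R, φ y * M (s ⁻¹' {(y : ℝ≥0∞)}) := by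
    have h1 : ∫⁻ x, φ (s x) ∂M = (s.map φ).lintegral M := by
      rw [← SimpleFunc.lintegral_eq_lintegral]; simp
    rw [h1, SimpleFunc.map_lintegral, Finset.sum_coe_sort R fun y => φ y * M (s ⁻¹' {y}),
      Finset.sum_filter_of_ne]
    rintro y - hy rfl
    exact hy (by simp [hφ])
  have hind : iIndepFun (fun (y : R) ω => N ω (s ⁻¹' {(y : ℝ≥0∞)})) P :=
    h.iIndepFun_count (fun y => s.measurableSet_fiber _) fun y z hyz =>
      Disjoint.preimage _ (disjoint_singleton.2 (Subtype.coe_ne_coe.2 hyz))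
  have hind' := hind.comp (fun (y : R) x => negExp (y * x)) fun y => by fun_prop
  rw [hsum Λ (fun y => 1 - negExp y) (by simp), negExp_sum]
  have hN (ω : Ω) : ∫⁻ x, s x ∂N ω = ∑ y : R, (y : ℝ≥0∞) * N ω (s ⁻¹' {(y : ℝ≥0∞)}) :=
    hsum (N ω) id rfl
  simp_rw [hN, negExp_sum]
  have := lintegral_prod_eq_prod_lintegral_of_indepFun (μ := P) Finset.univ _ hind'
    (fun y => (by fun_prop : Measurable fun x => negExp ((y : ℝ≥0∞) * x)).comp
      (h.measurable_apply (s.measurableSet_fiber _)))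
  simp only [Function.comp_def] at this
  rw [this]
  refine Finset.prod_congr rfl fun y _ => h.lintegral_negExp_mul_count (s.measurableSet_fiber _) ?_ _
  exact (SimpleFunc.finMeasSupp_iff.1 hs y (Finset.mem_filter.1 y.2).2).ne

/-- Laplace functional of a Poisson point field. -/
theorem lintegral_negExp_lintegral [SigmaFinite Λ] [IsFiniteMeasure P]
    (h : IsPoissonPointField P N Λ)
    {f : E → ℝ≥0∞} (hf : Measurable f) :
    ∫⁻ ω, negExp (∫⁻ x, f x ∂N ω) ∂P = negExp (∫⁻ x, (1 - negExp (f x)) ∂Λ) := by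
  let A := spanningSets Λ
  have hA n : MeasurableSet (A n) := measurableSet_spanningSets Λ n
  -- Cutting off to spanning sets gives finite-intensity support, and the sequence still increases
  -- to `f`.
  let s n : SimpleFunc E ℝ≥0∞ := (SimpleFunc.eapprox f n).restrict (A n)
  have hs n : (s n).FinMeasSupp Λ := by
    rw [SimpleFunc.finMeasSupp_iff_support]
    refine (measure_mono ?_).trans_lt (measure_spanningSets_lt_top Λ n)
    intro x hx
    by_contra hxA
    exact hx (by simp only [s, SimpleFunc.restrict_apply _ (hA n)]; exact indicator_of_notMem hxA _)
  have hmono (x : E) : Monotone fun n => s n x := by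
    intro m n hmn
    simp only [s, SimpleFunc.restrict_apply _ (hA _)]
    refine (indicator_le_indicator_of_subset (monotone_spanningSets Λ hmn) (fun _ => zero_le) x).trans
      (indicator_le_indicator (SimpleFunc.monotone_eapprox f hmn x))
  have hlim (x : E) : Tendsto (fun n => s n x) atTop (𝓝 (f x)) := by
    refine (SimpleFunc.tendsto_eapprox hf x).congr' ?_
    filter_upwards [eventually_ge_atTop (spanningSetsIndex Λ x)] with n hn
    simp only [s, SimpleFunc.restrict_apply _ (hA n)]
    exact (indicator_of_mem (monotone_spanningSets Λ hn (mem_spanningSetsIndex Λ x)) _).symm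
  have hL : Tendsto (fun n => ∫⁻ ω, negExp (∫⁻ x, s n x ∂N ω) ∂P) atTop
      (𝓝 (∫⁻ ω, negExp (∫⁻ x, f x ∂N ω) ∂P)) := by
    refine tendsto_lintegral_negExp
      (fun n => (Measure.measurable_lintegral (s n).measurable).comp h.measurable) fun ω => ?_
    -- Monotone convergence is applied to each realization `N ω` separately; `negExp` then allows
    -- bounded convergence in `ω`.
    exact lintegral_tendsto_of_tendsto_of_monotone (fun n => (s n).measurable.aemeasurable)
      (.of_forall hmono) (.of_forall hlim)
  have hR : Tendsto (fun n => ∫⁻ x, (1 - negExp (s n x)) ∂Λ) atTop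
      (𝓝 (∫⁻ x, (1 - negExp (f x)) ∂Λ)) := by
    refine lintegral_tendsto_of_tendsto_of_monotone (fun n => by fun_prop)
      (.of_forall fun x m n hmn => tsub_le_tsub_left (negExp_antitone (hmono x hmn)) _)
      (.of_forall fun x => ?_)
    exact ENNReal.Tendsto.sub tendsto_const_nhds ((continuous_negExp.tendsto _).comp (hlim x))
      (.inl ENNReal.one_ne_top)
  refine tendsto_nhds_unique hL ?_
  simp_rw [h.lintegral_negExp_simpleFunc _ (hs _)]
  exact (continuous_negExp.tendsto _).comp hR

end IsPoissonPointField

end IoT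

namespace IoT

open Filter Topology

-- Conditioning by resampling independent coordinates.

section Independence

variable {Ω α β γ : Type*} [MeasurableSpace Ω] [MeasurableSpace α] [MeasurableSpace β]
  [MeasurableSpace γ] {P : Measure Ω}

/-- The joint law is the product of the marginals, so this is Tonelli, written without naming the
laws: `X` can be frozen while `Y` is averaged. -/
lemma lintegral_indepFun [IsFiniteMeasure P] {X : Ω → α} {Y : Ω → β} (h : IndepFun X Y P)
    (hX : Measurable X) (hY : Measurable Y) {F : α → β → ℝ≥0∞}
    (hF : Measurable (Function.uncurry F)) :
    ∫⁻ ω, F (X ω) (Y ω) ∂P = ∫⁻ ω, ∫⁻ ω', F (X ω) (Y ω') ∂P ∂P := by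
  have h1 := (indepFun_iff_map_prod_eq_prod_map_map hX.aemeasurable hY.aemeasurable).1 h
  calc ∫⁻ ω, F (X ω) (Y ω) ∂P
      = ∫⁻ z, Function.uncurry F z ∂(P.map fun ω => (X ω, Y ω)) := by
        rw [lintegral_map hF (hX.prodMk hY)]; rfl
    _ = ∫⁻ x, ∫⁻ y, F x y ∂(P.map Y) ∂(P.map X) := by
        rw [h1, lintegral_prod _ hF.aemeasurable]; rfl
    _ = ∫⁻ ω, ∫⁻ y, F (X ω) y ∂(P.map Y) ∂P := by
        rw [lintegral_map (by fun_prop) hX]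
    _ = _ := by
        congr 1 with ω
        rw [lintegral_map (by fun_prop) hY]

variable {Z : ℕ → Ω → β}

lemma indepFun_ne_of_iIndepFun (hind : iIndepFun Z P) (hZ : ∀ i, Measurable (Z i)) (i : ℕ) :
    IndepFun (fun ω (j : {j // j ≠ i}) => Z j ω) (Z i) P := by
  have h := indep_iSup_of_disjoint (S := {i}ᶜ) (T := {i}) (fun j => (hZ j).comap_le)
    ((iIndepFun_iff_iIndep _ _ _).1 hind) (by simp)
  rw [IndepFun_iff_Indep]
  refine indep_of_indep_of_le_left (indep_of_indep_of_le_right h ?_) ?_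
  · simp
  · rw [MeasurableSpace.pi, MeasurableSpace.comap_iSup]
    refine iSup_le fun j => ?_
    rw [MeasurableSpace.comap_comp]
    exact le_iSup₂_of_le (f := fun j (_ : j ∈ ({i}ᶜ : Set ℕ)) => MeasurableSpace.comap (Z j) _)
      (j : ℕ) j.2 le_rfl

/-- Independent resampling of one member of an independent family. -/
lemma lintegral_resample [IsFiniteMeasure P] (hind : iIndepFun Z P) (hZ : ∀ i, Measurable (Z i))
    (i : ℕ) {F : (ℕ → β) → ℝ≥0∞} (hF : Measurable F) :
    ∫⁻ ω, F (fun j => Z j ω) ∂P =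
      ∫⁻ ω, ∫⁻ ω', F (Function.update (fun j => Z j ω) i (Z i ω')) ∂P ∂P := by
  -- `E` inserts `b` at coordinate `i`; the updated sequence depends only on the other coordinates
  -- and on the fresh copy.
  let E (y : {j // j ≠ i} → β) (b : β) : ℕ → β := fun j => if h : j = i then b else y ⟨j, h⟩
  have hE : Measurable (Function.uncurry E) := by
    refine measurable_pi_lambda _ fun j => ?_
    by_cases h : j = i
    · simpa [E, h, Function.uncurry_def] using measurable_snd
    · simp only [E, h, Function.uncurry_def, dite_false]
      fun_prop
  have hEu (ω ω' : Ω) : E (fun j => Z j ω) (Z i ω') =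
      Function.update (fun j => Z j ω) i (Z i ω') := by
    ext j
    by_cases h : j = i
    · subst h; simp [E]
    · simp [E, h]
  have h := lintegral_indepFun (indepFun_ne_of_iIndepFun hind hZ i) (by fun_prop) (hZ i)
    (F := fun y b => F (E y b)) (hF.comp hE)
  simp_rw [hEu, Function.update_eq_self_iff.2] at h
  simpa using h

variable {m : β → γ}

/-- Once coordinate `i` is resampled and the others are frozen, `H` is a constant and `G` is a
function of `m (Z i)` only, so it can serve as the test function `u` in `hAB`. -/
lemma lintegral_replace_factor [IsFiniteMeasure P] (hind : iIndepFun Z P)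
    (hZ : ∀ i, Measurable (Z i)) (hm : Measurable m) {i : ℕ} {A : β → ℝ≥0∞} {B : γ → ℝ≥0∞}
    (hA : Measurable A) (hB : Measurable B)
    (hAB : ∀ u : γ → ℝ≥0∞, Measurable u →
      ∫⁻ ω, u (m (Z i ω)) * A (Z i ω) ∂P = ∫⁻ ω, u (m (Z i ω)) * B (m (Z i ω)) ∂P)
    {G : (ℕ → γ) → ℝ≥0∞} (hG : Measurable G) {H : (ℕ → β) → ℝ≥0∞} (hH : Measurable H)
    (hHi : ∀ z b, H (Function.update z i b) = H z) :
    ∫⁻ ω, G (fun j => m (Z j ω)) * H (fun j => Z j ω) * A (Z i ω) ∂P =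
      ∫⁻ ω, G (fun j => m (Z j ω)) * H (fun j => Z j ω) * B (m (Z i ω)) ∂P := by
  have key {C : β → ℝ≥0∞} (hC : Measurable C) :
      ∫⁻ ω, G (fun j => m (Z j ω)) * H (fun j => Z j ω) * C (Z i ω) ∂P =
        ∫⁻ ω, H (fun j => Z j ω) * ∫⁻ ω', G (Function.update (fun j => m (Z j ω)) i (m (Z i ω')))
          * C (Z i ω') ∂P ∂P := by
    have h := lintegral_resample hind hZ i
      (F := fun z => G (fun j => m (z j)) * H z * C (z i)) (by fun_prop)
    rw [h]
    congr 1 with ω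
    have hu : Measurable fun c => G (Function.update (fun j => m (Z j ω)) i c) :=
      hG.comp (measurable_update _)
    have hv : Measurable fun ω' => G (Function.update (fun j => m (Z j ω)) i (m (Z i ω'))) *
        C (Z i ω') := ((hu.comp hm).mul hC).comp (hZ i)
    rw [← lintegral_const_mul _ hv]
    congr 1 with ω'
    have : (fun j => m (Function.update (fun j => Z j ω) i (Z i ω') j)) =
        Function.update (fun j => m (Z j ω)) i (m (Z i ω')) := by
      ext j
      by_cases hj : j = i
      · subst hj; simp
      · simp [hj]
    simp only [this, hHi, Function.update_self]
    ring
  rw [key hA, key (C := fun b => B (m b)) (hB.comp hm)]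
  congr 1 with ω
  congr 1
  exact hAB (fun c => G (Function.update (fun j => m (Z j ω)) i c)) (hG.comp (measurable_update _))

/-- The last factor is replaced first, the earlier ones playing the role of `H`. The new factor
depends only on `m (Z n)` and is absorbed into `G`, which is why the induction generalizes over `G`.
-/
lemma lintegral_replace_prod [IsFiniteMeasure P] (hind : iIndepFun Z P)
    (hZ : ∀ i, Measurable (Z i)) (hm : Measurable m) {A : ℕ → β → ℝ≥0∞} {B : ℕ → γ → ℝ≥0∞}
    (hA : ∀ i, Measurable (A i)) (hB : ∀ i, Measurable (B i))
    (hAB : ∀ i, ∀ u : γ → ℝ≥0∞, Measurable u →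
      ∫⁻ ω, u (m (Z i ω)) * A i (Z i ω) ∂P = ∫⁻ ω, u (m (Z i ω)) * B i (m (Z i ω)) ∂P)
    (n : ℕ) {G : (ℕ → γ) → ℝ≥0∞} (hG : Measurable G) :
    ∫⁻ ω, G (fun j => m (Z j ω)) * ∏ i ∈ Finset.range n, A i (Z i ω) ∂P =
      ∫⁻ ω, G (fun j => m (Z j ω)) * ∏ i ∈ Finset.range n, B i (m (Z i ω)) ∂P := by
  induction n generalizing G with
  | zero => simp
  | succ n ih =>
    have h1 := lintegral_replace_factor hind hZ hm (hA n) (hB n) (hAB n) hG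
      (H := fun z => ∏ i ∈ Finset.range n, A i (z i)) (by fun_prop) (fun z b => by
        refine Finset.prod_congr rfl fun i hi => ?_
        rw [Function.update_of_ne (Finset.mem_range.1 hi).ne])
    have h2 := ih (G := fun c => G c * B n (c n)) (by fun_prop)
    simp_rw [Finset.prod_range_succ, ← mul_assoc]
    rw [h1]
    simpa only [mul_right_comm] using h2

/-- If, for every `i`, `exp (-b i)` is the conditional expectation of `exp (-a i (Z i))` given
`m (Z i)`, then the conditional expectation of `exp (-∑ a i (Z i))` given all the `m (Z i)`
is `exp (-∑ b i (m (Z i)))`. -/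
lemma lintegral_replace_negExp_tsum [IsProbabilityMeasure P] (hind : iIndepFun Z P)
    (hZ : ∀ i, Measurable (Z i)) (hm : Measurable m) {a : ℕ → β → ℝ≥0∞} {b : ℕ → γ → ℝ≥0∞}
    (ha : ∀ i, Measurable (a i)) (hb : ∀ i, Measurable (b i))
    (hab : ∀ i, ∀ u : γ → ℝ≥0∞, Measurable u →
      ∫⁻ ω, u (m (Z i ω)) * negExp (a i (Z i ω)) ∂P =
        ∫⁻ ω, u (m (Z i ω)) * negExp (b i (m (Z i ω))) ∂P)
    {G : (ℕ → γ) → ℝ≥0∞} (hG : Measurable G) (hG1 : ∀ c, G c ≤ 1) :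
    ∫⁻ ω, G (fun j => m (Z j ω)) * negExp (∑' i, a i (Z i ω)) ∂P =
      ∫⁻ ω, G (fun j => m (Z j ω)) * negExp (∑' i, b i (m (Z i ω))) ∂P := by
  have key (c : ℕ → β → ℝ≥0∞) (hc : ∀ i, Measurable (c i)) :
      Tendsto (fun n => ∫⁻ ω, G (fun j => m (Z j ω)) *
          ∏ i ∈ Finset.range n, negExp (c i (Z i ω)) ∂P) atTop
        (𝓝 (∫⁻ ω, G (fun j => m (Z j ω)) * negExp (∑' i, c i (Z i ω)) ∂P)) := by
    refine tendsto_lintegral_of_dominated_convergence (fun _ => 1) (fun n => by fun_prop)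
      (fun n => .of_forall fun ω => ?_) (by simp) (.of_forall fun ω => ?_)
    · exact mul_le_one' (hG1 _) (Finset.prod_le_one' fun i _ => negExp_le_one _)
    · exact ENNReal.Tendsto.const_mul (tendsto_prod_negExp _)
        (.inr (ne_top_of_le_ne_top ENNReal.one_ne_top (hG1 _)))
  refine tendsto_nhds_unique (key a ha) ?_
  simp_rw [lintegral_replace_prod hind hZ hm (A := fun i z => negExp (a i z))
    (B := fun i z => negExp (b i z)) (fun i => by fun_prop) (fun i => by fun_prop) hab _ hG]
  exact key (fun i z => b i (m z)) fun i => by fun_prop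

end Independence

end IoT

-- Path-loss integrals over the plane.

namespace IoT

/-- The integral of a Gaussian-type function with exponent `η` over the plane. -/
lemma integral_plane_exp_neg_mul_rpow {t η : ℝ} (ht : 0 < t) (hη : 0 < η) :
    ∫ x : Plane, Real.exp (-t * ‖x‖ ^ η) =
      2 * Real.pi / η * Real.Gamma (2 / η) * t ^ (-(2 / η)) := by
  rw [integral_fun_norm_addHaar volume (fun r => Real.exp (-t * r ^ η))]
  have h := integral_rpow_mul_exp_neg_mul_rpow (p := η) (q := 1) (b := t) hη (by norm_num) ht
  have h2 : ∫ y in Ioi (0 : ℝ), y ^ (Module.finrank ℝ Plane - 1) • Real.exp (-t * y ^ η) =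
      ∫ y in Ioi (0 : ℝ), y ^ (1 : ℝ) * Real.exp (-t * y ^ η) := by
    simp
  rw [h2, h]
  have hb : (volume : Measure Plane).real (Metric.ball 0 1) = Real.pi := by
    rw [measureReal_def, EuclideanSpace.volume_ball_fin_two]
    simp [Real.pi_pos.le]
  rw [hb]
  simp only [finrank_euclideanSpace, Fintype.card_fin, smul_eq_mul, nsmul_eq_mul]
  norm_num
  rw [neg_div]
  ring

lemma lintegral_plane_exp_neg_mul_rpow {t η : ℝ} (ht : 0 < t) (hη : 0 < η) :
    ∫⁻ x : Plane, ENNReal.ofReal (Real.exp (-t * ‖x‖ ^ η)) =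
      ENNReal.ofReal (2 * Real.pi / η * Real.Gamma (2 / η) * t ^ (-(2 / η))) := by
  have h := integral_plane_exp_neg_mul_rpow ht hη
  have hpos : 0 < 2 * Real.pi / η * Real.Gamma (2 / η) * t ^ (-(2 / η)) := by
    have := Real.Gamma_pos_of_pos (show 0 < 2 / η by positivity)
    positivity
  -- The Bochner integral of a non-integrable function is `0` by convention, so a positive value
  -- already proves integrability.
  rw [← h, ofReal_integral_eq_lintegral_ofReal (.of_integral_ne_zero (by rw [h]; exact hpos.ne'))
    (.of_forall fun x => (Real.exp_pos _).le)]

lemma lintegral_rpow_mul_exp_neg_mul {a r : ℝ} (ha : 0 < a) (hr : 0 < r) :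
    ∫⁻ t in Ioi (0 : ℝ), ENNReal.ofReal (t ^ (a - 1) * Real.exp (-(r * t))) =
      ENNReal.ofReal ((1 / r) ^ a * Real.Gamma a) := by
  have h := Real.integral_rpow_mul_exp_neg_mul_Ioi ha hr
  have hpos : 0 < (1 / r) ^ a * Real.Gamma a := by
    have := Real.Gamma_pos_of_pos ha
    positivity
  rw [← h, ofReal_integral_eq_lintegral_ofReal (.of_integral_ne_zero (by rw [h]; exact hpos.ne'))]
  refine (ae_restrict_iff' measurableSet_Ioi).2 (.of_forall fun t (ht : 0 < t) => ?_)
  positivity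

/-- Integral over the plane of a power of `c / (‖x‖ ^ η + c)`. -/
lemma lintegral_plane_rpow_div_add {c η j : ℝ} (hc : 0 < c) (hη : 2 < η) (hj : 1 ≤ j) :
    ∫⁻ x : Plane, ENNReal.ofReal ((c / (‖x‖ ^ η + c)) ^ j) =
      ENNReal.ofReal (2 * Real.pi / η * c ^ (2 / η) *
        (Real.Gamma (2 / η) * Real.Gamma (j - 2 / η) / Real.Gamma j)) := by
  have hη0 : 0 < η := by linarith
  have hj0 : 0 < j := by linarith
  have hδ : 2 / η < 1 := (div_lt_one hη0).2 hη
  have hΓj := Real.Gamma_pos_of_pos hj0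
  have hΓδ := Real.Gamma_pos_of_pos (show 0 < 2 / η by positivity)
  -- The power is written as a Gamma integral in `t`. After Tonelli, the plane integral contributes
  -- `t ^ (-(2 / η))`, and a second Gamma integral remains; it converges because `2 / η < 1 ≤ j`.
  have hstep (x : Plane) : ENNReal.ofReal ((c / (‖x‖ ^ η + c)) ^ j) =
      ∫⁻ t in Ioi (0 : ℝ), ENNReal.ofReal (c ^ j / Real.Gamma j * t ^ (j - 1) *
        Real.exp (-(c * t))) * ENNReal.ofReal (Real.exp (-t * ‖x‖ ^ η)) := by
    have hx : 0 < ‖x‖ ^ η + c := by positivity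
    have h1 : (c / (‖x‖ ^ η + c)) ^ j =
        c ^ j / Real.Gamma j * ((1 / (‖x‖ ^ η + c)) ^ j * Real.Gamma j) := by
      rw [div_eq_mul_one_div c, Real.mul_rpow hc.le (by positivity)]
      field_simp
    rw [h1, ENNReal.ofReal_mul (by positivity), ← lintegral_rpow_mul_exp_neg_mul hj0 hx,
      ← lintegral_const_mul _ (by fun_prop)]
    refine setLIntegral_congr_fun measurableSet_Ioi fun t (ht : 0 < t) => ?_
    rw [← ENNReal.ofReal_mul (by positivity), ← ENNReal.ofReal_mul (by positivity), mul_assoc,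
      mul_assoc, ← Real.exp_add]
    ring_nf
  simp_rw [hstep]
  rw [lintegral_lintegral_swap (by fun_prop)]
  have hinner (t : ℝ) (ht : t ∈ Ioi (0 : ℝ)) :
      ∫⁻ x : Plane, ENNReal.ofReal (c ^ j / Real.Gamma j * t ^ (j - 1) *
        Real.exp (-(c * t))) * ENNReal.ofReal (Real.exp (-t * ‖x‖ ^ η)) =
      ENNReal.ofReal (c ^ j / Real.Gamma j * (2 * Real.pi / η * Real.Gamma (2 / η))) *
        ENNReal.ofReal (t ^ (j - 2 / η - 1) * Real.exp (-(c * t))) := by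
    have ht0 : (0 : ℝ) < t := ht
    rw [lintegral_const_mul _ (by fun_prop), lintegral_plane_exp_neg_mul_rpow ht0 hη0,
      ← ENNReal.ofReal_mul (by positivity), ← ENNReal.ofReal_mul (by positivity)]
    have : t ^ (j - 2 / η - 1) = t ^ (j - 1) * t ^ (-(2 / η)) := by
      rw [← Real.rpow_add ht0]; ring_nf
    rw [this]
    ring_nf
  rw [setLIntegral_congr_fun measurableSet_Ioi hinner, lintegral_const_mul _ (by fun_prop),
    lintegral_rpow_mul_exp_neg_mul (by linarith) hc, ← ENNReal.ofReal_mul (by positivity)]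
  have : c ^ (2 / η) = c ^ j * (1 / c) ^ (j - 2 / η) := by
    rw [one_div, Real.inv_rpow hc.le, ← Real.rpow_neg hc.le, ← Real.rpow_add hc]
    ring_nf
  rw [this]
  ring_nf

lemma integral_plane_rpow_div_add {c η j : ℝ} (hc : 0 < c) (hη : 2 < η) (hj : 1 ≤ j) :
    Integrable (fun x : Plane => (c / (‖x‖ ^ η + c)) ^ j) ∧
    ∫ x : Plane, (c / (‖x‖ ^ η + c)) ^ j =
      2 * Real.pi / η * c ^ (2 / η) *
        (Real.Gamma (2 / η) * Real.Gamma (j - 2 / η) / Real.Gamma j) := by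
  have hη0 : 0 < η := by linarith
  have hδ : 2 / η < 1 := (div_lt_one hη0).2 hη
  have h := lintegral_plane_rpow_div_add hc hη hj
  have hΓj := Real.Gamma_pos_of_pos (show 0 < j by linarith)
  have hΓδ := Real.Gamma_pos_of_pos (show 0 < 2 / η by positivity)
  have hΓδ' := Real.Gamma_pos_of_pos (show 0 < j - 2 / η by linarith)
  have hnn : 0 ≤ᵐ[volume] fun x : Plane => (c / (‖x‖ ^ η + c)) ^ j :=
    .of_forall fun x => by positivity
  have hm : AEStronglyMeasurable (fun x : Plane => (c / (‖x‖ ^ η + c)) ^ j) volume :=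
    Measurable.aestronglyMeasurable (by fun_prop)
  refine ⟨⟨hm, ?_⟩, ?_⟩
  · rw [hasFiniteIntegral_iff_ofReal hnn, h]
    exact ENNReal.ofReal_lt_top
  · rw [integral_eq_lintegral_of_nonneg_ae hnn hm, h, ENNReal.toReal_ofReal (by positivity)]

/-- For `j = 1` the Gamma factors are `Γ(δ) Γ(1 - δ)` with `δ = 2 / η`, and Euler reflection
produces the sine. -/
lemma integral_plane_div_add {c η : ℝ} (hc : 0 < c) (hη : 2 < η) :
    Integrable (fun x : Plane => c / (‖x‖ ^ η + c)) ∧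
    ∫ x : Plane, c / (‖x‖ ^ η + c) =
      2 * Real.pi ^ 2 / (η * Real.sin (2 * Real.pi / η)) * c ^ (2 / η) := by
  have h := integral_plane_rpow_div_add hc hη le_rfl
  simp only [Real.rpow_one, Real.Gamma_one, Real.Gamma_mul_Gamma_one_sub] at h
  refine ⟨h.1, h.2.trans ?_⟩
  rw [show Real.pi * (2 / η) = 2 * Real.pi / η by ring]
  field_simp

/-- For `j = 2`, `Γ(2 - δ) = (1 - δ) Γ(1 - δ)` reduces to the previous case at the cost of the
factor `1 - 2 / η`. -/
lemma integral_plane_div_add_sq {c η : ℝ} (hc : 0 < c) (hη : 2 < η) :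
    Integrable (fun x : Plane => (c / (‖x‖ ^ η + c)) ^ 2) ∧
    ∫ x : Plane, (c / (‖x‖ ^ η + c)) ^ 2 =
      2 * Real.pi ^ 2 / (η * Real.sin (2 * Real.pi / η)) * c ^ (2 / η) * (1 - 2 / η) := by
  have h := integral_plane_rpow_div_add hc hη one_le_two
  have hδ : 2 / η < 1 := (div_lt_one (by linarith)).2 hη
  have h2 : Real.Gamma (2 - 2 / η) = (1 - 2 / η) * Real.Gamma (1 - 2 / η) := by
    rw [← Real.Gamma_add_one (by linarith)]; ring_nf
  simp only [Real.rpow_two, Real.Gamma_two, h2, mul_left_comm (Real.Gamma (2 / η)),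
    Real.Gamma_mul_Gamma_one_sub] at h
  refine ⟨h.1, h.2.trans ?_⟩
  rw [show Real.pi * (2 / η) = 2 * Real.pi / η by ring]
  field_simp

end IoT

-- Moments and tails of beta distributions.

namespace IoT

section Beta

variable {a b : ℝ}

lemma betaPDFReal_nonneg (ha : 0 < a) (hb : 0 < b) (x : ℝ) : 0 ≤ betaPDFReal a b x := by
  by_cases h : 0 < x ∧ x < 1
  · exact (betaPDFReal_pos h.1 h.2 ha hb).le
  · simp [betaPDFReal, h]

/-- Size-biasing a beta law raises its first parameter by one; the constant is `B(a + 1, b) / B(a,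
b)`. Iterating this gives the moments. -/
lemma betaPDFReal_mul_self (ha : 0 < a) (hb : 0 < b) (x : ℝ) :
    betaPDFReal a b x * x = a / (a + b) * betaPDFReal (a + 1) b x := by
  by_cases h : 0 < x ∧ x < 1
  · have h1 : beta (a + 1) b = a / (a + b) * beta a b := by
      rw [beta, beta, Real.Gamma_add_one ha.ne', add_right_comm, Real.Gamma_add_one (by linarith)]
      field_simp
    have h2 : x ^ (a + 1 - 1) = x ^ (a - 1) * x := by
      rw [← Real.rpow_add_one h.1.ne']; ring_nf
    have := beta_pos ha hb
    rw [betaPDFReal, betaPDFReal, if_pos h, if_pos h, h1, h2]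
    field_simp
  · simp [betaPDFReal, h]

lemma integral_betaMeasure (ha : 0 < a) (hb : 0 < b) (f : ℝ → ℝ) :
    ∫ t, f t ∂(betaMeasure a b) = ∫ t, betaPDFReal a b t * f t := by
  have hm : Measurable (betaPDF a b) := (measurable_betaPDFReal a b).ennreal_ofReal
  rw [betaMeasure, integral_withDensity_eq_integral_toReal_smul hm
    (.of_forall fun _ => ENNReal.ofReal_lt_top)]
  simp [betaPDF, betaPDFReal_nonneg ha hb]

lemma integral_mul_self_betaMeasure (ha : 0 < a) (hb : 0 < b) (f : ℝ → ℝ) :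
    ∫ t, t * f t ∂(betaMeasure a b) = a / (a + b) * ∫ t, f t ∂(betaMeasure (a + 1) b) := by
  rw [integral_betaMeasure ha hb, integral_betaMeasure (by linarith) hb, ← integral_const_mul]
  congr 1 with t
  rw [← mul_assoc, betaPDFReal_mul_self ha hb, mul_assoc]

lemma integral_id_betaMeasure (ha : 0 < a) (hb : 0 < b) :
    ∫ t, t ∂(betaMeasure a b) = a / (a + b) := by
  have := isProbabilityMeasureBeta (show 0 < a + 1 by linarith) hb
  simpa using integral_mul_self_betaMeasure ha hb fun _ => 1

lemma integral_sq_betaMeasure (ha : 0 < a) (hb : 0 < b) :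
    ∫ t, t ^ 2 ∂(betaMeasure a b) = a / (a + b) * ((a + 1) / (a + b + 1)) := by
  have h := integral_mul_self_betaMeasure ha hb fun t => t
  rw [integral_id_betaMeasure (by linarith) hb, add_right_comm] at h
  simpa only [sq] using h

lemma ae_betaMeasure_mem_Icc : ∀ᵐ t ∂(betaMeasure a b), t ∈ Icc (0 : ℝ) 1 := by
  have hm : Measurable (betaPDF a b) := (measurable_betaPDFReal a b).ennreal_ofReal
  rw [betaMeasure, ae_withDensity_iff hm]
  refine .of_forall fun t ht => ?_
  by_contra h
  rw [mem_Icc, not_and_or, not_le, not_le] at h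
  rcases h with h | h
  · exact ht (betaPDF_eq_zero_of_nonpos h.le)
  · exact ht (betaPDF_eq_zero_of_one_le h.le)

/-- Complementary distribution function of the beta distribution. -/
lemma betaMeasure_real_Ioi (ha : 0 < a) (hb : 0 < b) {γ : ℝ} (hγ : γ ∈ Icc (0 : ℝ) 1) :
    (betaMeasure a b).real (Ioi γ) = 1 - regIncBeta a b γ := by
  have := isProbabilityMeasureBeta ha hb
  rw [← compl_Iic, probReal_compl_eq_one_sub measurableSet_Iic, regIncBeta]
  congr 1
  rw [← integral_indicator_one measurableSet_Iic, integral_betaMeasure ha hb]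
  have h : (fun t => betaPDFReal a b t * (Iic γ).indicator 1 t) =ᵐ[volume]
      (Ioc 0 γ).indicator fun t => 1 / beta a b * (t ^ (a - 1) * (1 - t) ^ (b - 1)) := by
    -- The point `1` matters only for `γ = 1`, `b = 1`: there `0 ^ 0 = 1`, while the density is `0`.
    filter_upwards [(measure_eq_zero_iff_ae_notMem).1 (measure_singleton (μ := volume) (1 : ℝ))]
      with t ht
    by_cases h0 : 0 < t
    · by_cases h1 : t ≤ γ
      · have h2 : t < 1 := lt_of_le_of_ne (h1.trans hγ.2) ht
        simp [betaPDFReal, h0, h1, h2, mul_assoc]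
      · simp [h1]
    · simp [betaPDFReal, h0]
  rw [integral_congr_ae h, integral_indicator measurableSet_Ioc, integral_const_mul,
    intervalIntegral.integral_of_le hγ.1]

/-- A beta distribution is determined by its first two moments. -/
lemma betaMeasure_moments_iff {μ ν : ℝ} (h1 : ν < μ) (h2 : μ ^ 2 < ν) (ha : 0 < a) (hb : 0 < b) :
    (∫ t, t ∂(betaMeasure a b) = μ ∧ ∫ t, t ^ 2 ∂(betaMeasure a b) = ν) ↔
      a = μ * (μ - ν) / (ν - μ ^ 2) ∧ b = (1 - μ) * (μ - ν) / (ν - μ ^ 2) := by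
  rw [integral_id_betaMeasure ha hb, integral_sq_betaMeasure ha hb]
  have hd : ν - μ ^ 2 ≠ 0 := by linarith
  have hs : 0 < a + b := by linarith
  constructor
  · rintro ⟨rfl, hν⟩
    -- This relation determines `a + b` from the moments; then `a = μ (a + b)` and `b = (1 - μ) (a +
    -- b)`.
    have hsum : (a + b) * (ν - (a / (a + b)) ^ 2) = a / (a + b) - ν := by
      rw [← hν]; field_simp; ring
    rw [← hsum, eq_div_iff hd, eq_div_iff hd]
    generalize ν - (a / (a + b)) ^ 2 = D
    constructor
    · field_simp
    · field_simp
      ring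
  · rintro ⟨ha', hb'⟩
    have hsum : a + b = (μ - ν) / (ν - μ ^ 2) := by
      rw [ha', hb']; field_simp; ring
    have hμ : a / (a + b) = μ := by
      rw [hsum, ha']
      have : μ - ν ≠ 0 := by linarith
      field_simp
    refine ⟨hμ, ?_⟩
    rw [hμ, hsum, ha']
    have h3 : (μ - ν) / (ν - μ ^ 2) + 1 = (μ - μ ^ 2) / (ν - μ ^ 2) := by field_simp; ring
    have h4 : μ * (μ - ν) / (ν - μ ^ 2) + 1 = ν * (1 - μ) / (ν - μ ^ 2) := by field_simp; ring
    have h5 : μ - μ ^ 2 ≠ 0 := by linarith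
    rw [h3, h4, div_div_div_cancel_right₀ hd, mul_div_assoc', div_eq_iff h5]
    ring

end Beta

-- Tail integrals and the beta fit.

/-- Layer cake formula for a random variable with values in `[0, 1]`. -/
lemma integral_mul_measureReal_lt {Ω : Type*} [MeasurableSpace Ω] {P : Measure Ω}
    [IsProbabilityMeasure P] {X : Ω → ℝ} (hX : AEMeasurable X P)
    (hX01 : ∀ᵐ ω ∂P, X ω ∈ Icc (0 : ℝ) 1) {g : ℝ → ℝ} (hg : Continuous g)
    (hg0 : ∀ t, 0 ≤ t → 0 ≤ g t) :
    ∫ γ in (0 : ℝ)..1, g γ * P.real {ω | γ < X ω} = ∫ ω, (∫ t in (0 : ℝ)..X ω, g t) ∂P := by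
  have hnn : 0 ≤ᵐ[P] X := hX01.mono fun ω h => h.1
  have key := lintegral_comp_eq_lintegral_meas_lt_mul P hnn hX
    (fun t _ => hg.intervalIntegrable 0 t)
    ((ae_restrict_iff' measurableSet_Ioi).2 (.of_forall fun t (ht : 0 < t) => hg0 t ht.le))
  have hmeas : Measurable fun γ => P.real {ω | γ < X ω} :=
    Antitone.measurable fun s t hst => measureReal_mono fun ω (h : t < X ω) => hst.trans_lt h
  have hprim : Continuous fun y => ∫ t in (0 : ℝ)..y, g t :=
    intervalIntegral.continuous_primitive (fun _ _ => hg.intervalIntegrable _ _) 0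
  rw [intervalIntegral.integral_of_le zero_le_one, integral_eq_lintegral_of_nonneg_ae,
    integral_eq_lintegral_of_nonneg_ae, key]
  · congr 1
    have hzero : ∀ γ ∈ Ioi (0 : ℝ) \ Ioc 0 1, P {ω | γ < X ω} * ENNReal.ofReal (g γ) = 0 := by
      intro γ hγ
      have h1 : 1 < γ := by
        by_contra h
        exact hγ.2 ⟨hγ.1, not_lt.1 h⟩
      have : P {ω | γ < X ω} = 0 := by
        refine measure_mono_null ?_ (ae_iff.1 hX01)
        intro ω (hω : γ < X ω) h
        linarith [h.2]
      rw [this, zero_mul]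
    have hsplit : ∫⁻ γ in Ioi (0 : ℝ), P {ω | γ < X ω} * ENNReal.ofReal (g γ) =
        ∫⁻ γ in Ioc (0 : ℝ) 1, P {ω | γ < X ω} * ENNReal.ofReal (g γ) := by
      rw [← Ioc_union_Ioi_eq_Ioi zero_le_one, lintegral_union measurableSet_Ioi
        (Ioc_disjoint_Ioi le_rfl), setLIntegral_eq_zero measurableSet_Ioi, add_zero]
      intro γ (hγ : 1 < γ)
      exact hzero γ ⟨zero_lt_one.trans hγ, fun h => by linarith [h.2]⟩
    rw [hsplit]
    refine setLIntegral_congr_fun measurableSet_Ioc fun γ hγ => ?_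
    rw [ENNReal.ofReal_mul (hg0 γ hγ.1.le), ofReal_measureReal, mul_comm]
  · filter_upwards [hX01] with ω hω
    exact intervalIntegral.integral_nonneg hω.1 fun t ht => hg0 t ht.1
  · exact (hprim.measurable.comp_aemeasurable hX).aestronglyMeasurable
  · exact (ae_restrict_iff' measurableSet_Ioc).2 (.of_forall fun t ht =>
      mul_nonneg (hg0 t ht.1.le) measureReal_nonneg)
  · exact (hg.measurable.mul hmeas).aestronglyMeasurable

lemma integral_measureReal_lt {Ω : Type*} [MeasurableSpace Ω] {P : Measure Ω}
    [IsProbabilityMeasure P] {X : Ω → ℝ} (hX : AEMeasurable X P)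
    (hX01 : ∀ᵐ ω ∂P, X ω ∈ Icc (0 : ℝ) 1) :
    ∫ γ in (0 : ℝ)..1, P.real {ω | γ < X ω} = ∫ ω, X ω ∂P := by
  simpa using integral_mul_measureReal_lt hX hX01 continuous_const (g := fun _ => 1) (by simp)

lemma integral_two_mul_measureReal_lt {Ω : Type*} [MeasurableSpace Ω] {P : Measure Ω}
    [IsProbabilityMeasure P] {X : Ω → ℝ} (hX : AEMeasurable X P)
    (hX01 : ∀ᵐ ω ∂P, X ω ∈ Icc (0 : ℝ) 1) :
    ∫ γ in (0 : ℝ)..1, 2 * γ * P.real {ω | γ < X ω} = ∫ ω, X ω ^ 2 ∂P := by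
  have h := integral_mul_measureReal_lt hX hX01 (g := fun t => 2 * t) (by fun_prop)
    (fun t ht => by linarith)
  rw [h]
  congr 1 with ω
  rw [intervalIntegral.integral_const_mul, integral_id]
  ring

/-- The layer cake formula is used twice, for `X` and for the identity under the beta law, so equal
moments become equal tail integrals. The hypotheses `μ² < ν < μ` force `0 < μ < 1`, hence positive
parameters. -/
lemma beta_fit_of_moments {Ω : Type*} [MeasurableSpace Ω] {P : Measure Ω}
    [IsProbabilityMeasure P] {X : Ω → ℝ} (hX : AEMeasurable X P)
    (hX01 : ∀ᵐ ω ∂P, X ω ∈ Icc (0 : ℝ) 1) {μ ν : ℝ} (hμ : μ = ∫ ω, X ω ∂P)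
    (hν : ν = ∫ ω, X ω ^ 2 ∂P) (h1 : ν < μ) (h2 : μ ^ 2 < ν) {a b : ℝ}
    (ha : a = μ * (μ - ν) / (ν - μ ^ 2)) (hb : b = (1 - μ) * (μ - ν) / (ν - μ ^ 2)) :
    0 < a ∧ 0 < b ∧
      (∀ a' b' : ℝ, 0 < a' → 0 < b' →
        ((∫ t, t ∂(betaMeasure a' b') = μ ∧ ∫ t, t ^ 2 ∂(betaMeasure a' b') = ν) ↔
          (a' = a ∧ b' = b))) ∧
      (∀ γ ∈ Icc (0 : ℝ) 1, (betaMeasure a b).real (Ioi γ) = 1 - regIncBeta a b γ) ∧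
      (∫ γ in (0 : ℝ)..1, P.real {ω | γ < X ω}) =
        (∫ γ in (0 : ℝ)..1, (1 - regIncBeta a b γ)) ∧
      (∫ γ in (0 : ℝ)..1, 2 * γ * P.real {ω | γ < X ω}) =
        ∫ γ in (0 : ℝ)..1, 2 * γ * (1 - regIncBeta a b γ) := by
  have hμ0 : 0 < μ := by nlinarith
  have hμ1 : μ < 1 := by nlinarith
  have hd : 0 < ν - μ ^ 2 := by linarith
  have hn : 0 < μ - ν := by linarith
  have ha0 : 0 < a := ha ▸ div_pos (mul_pos hμ0 hn) hd
  have hb0 : 0 < b := hb ▸ div_pos (mul_pos (by linarith) hn) hd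
  have hccdf (γ : ℝ) (hγ : γ ∈ Icc (0 : ℝ) 1) := betaMeasure_real_Ioi ha0 hb0 hγ
  have := isProbabilityMeasureBeta ha0 hb0
  have hmom := (betaMeasure_moments_iff h1 h2 ha0 hb0).2 ⟨ha, hb⟩
  refine ⟨ha0, hb0, fun a' b' ha' hb' => ?_, hccdf, ?_, ?_⟩
  · rw [ha, hb]
    exact betaMeasure_moments_iff h1 h2 ha' hb'
  · rw [integral_measureReal_lt hX hX01, ← hμ, ← hmom.1,
      ← integral_measureReal_lt aemeasurable_id' ae_betaMeasure_mem_Icc]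
    refine intervalIntegral.integral_congr fun γ hγ => ?_
    rw [uIcc_of_le zero_le_one] at hγ
    exact hccdf γ hγ
  · rw [integral_two_mul_measureReal_lt hX hX01, ← hν, ← hmom.2,
      ← integral_two_mul_measureReal_lt aemeasurable_id' ae_betaMeasure_mem_Icc]
    refine intervalIntegral.integral_congr fun γ hγ => ?_
    rw [uIcc_of_le zero_le_one] at hγ
    exact congrArg (2 * γ * ·) (hccdf γ hγ)

end IoT

-- Exponential gains.

namespace IoT

section Exponential

lemma lintegral_expMeasure_one (f : ℝ → ℝ≥0∞) (hf : Measurable f) :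
    ∫⁻ x, f x ∂(expMeasure 1) = ∫⁻ x in Ioi (0 : ℝ), ENNReal.ofReal (Real.exp (-x)) * f x := by
  have h0 : expMeasure 1 = volume.withDensity (exponentialPDF 1) := rfl
  have hm : Measurable (exponentialPDF 1) := (measurable_exponentialPDFReal 1).ennreal_ofReal
  rw [h0, lintegral_withDensity_eq_lintegral_mul _ hm hf, ← setLIntegral_univ, ← Iio_union_Ici,
    lintegral_union measurableSet_Ici (by simp [disjoint_left]),
    setLIntegral_eq_zero measurableSet_Iio, zero_add, setLIntegral_congr Ioi_ae_eq_Ici.symm]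
  · refine setLIntegral_congr_fun measurableSet_Ioi fun x (hx : 0 < x) => ?_
    simp [exponentialPDF_of_nonneg hx.le]
  · intro x (hx : x < 0)
    simp [exponentialPDF_of_neg hx]

/-- Laplace transform of the exponential distribution. -/
lemma lintegral_negExp_mul_expMeasure (t : ℝ≥0∞) :
    ∫⁻ x, negExp (ENNReal.ofReal x * t) ∂(expMeasure 1) = (1 + t)⁻¹ := by
  rw [lintegral_expMeasure_one _ (by fun_prop)]
  induction t with
  | top =>
    rw [setLIntegral_eq_zero measurableSet_Ioi]
    · simp
    · intro x (hx : 0 < x)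
      simp [ENNReal.mul_top (ENNReal.ofReal_pos.2 hx).ne']
  | coe t =>
    have ht : (0 : ℝ) < 1 + t := by positivity
    have h := lintegral_rpow_mul_exp_neg_mul one_pos ht
    rw [Real.rpow_one, Real.Gamma_one, mul_one, one_div, ENNReal.ofReal_inv_of_pos ht,
      ENNReal.ofReal_add zero_le_one t.coe_nonneg, ENNReal.ofReal_one,
      ENNReal.ofReal_coe_nnreal] at h
    rw [← h]
    refine setLIntegral_congr_fun measurableSet_Ioi fun x (hx : 0 < x) => ?_
    rw [← ENNReal.ofReal_coe_nnreal, ← ENNReal.ofReal_mul hx.le, negExp_ofReal (by positivity),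
      ← ENNReal.ofReal_mul (Real.exp_pos _).le, ← Real.exp_add, sub_self, Real.rpow_zero, one_mul]
    ring_nf

/-- With `t` the normalized interference, this turns the success event into an exponential that
factors over the devices. -/
lemma expMeasure_one_setOf_lt_ofReal (t : ℝ≥0∞) :
    expMeasure 1 {x | t < ENNReal.ofReal x} = negExp t := by
  have := isProbabilityMeasure_expMeasure one_pos
  induction t with
  | top => simp
  | coe t =>
    have h1 : {x : ℝ | (t : ℝ≥0∞) < ENNReal.ofReal x} = (Iic (t : ℝ))ᶜ := by
      ext x
      rw [mem_ofPred_eq, ← ENNReal.ofReal_coe_nnreal, ENNReal.ofReal_lt_ofReal_iff_of_nonneg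
        t.coe_nonneg]
      simp
    rw [h1, ← ofReal_measureReal, probReal_compl_eq_one_sub measurableSet_Iic, ← cdf_eq_real,
      cdf_expMeasure_eq one_pos, if_pos t.coe_nonneg, sub_sub_cancel, one_mul,
      ← negExp_ofReal t.coe_nonneg, ENNReal.ofReal_coe_nnreal]

end Exponential

-- Normalized interference and the success event.

namespace Params

variable {V : ℕ} (p : Params V) (n : ℕ)

/-- Mean interference from an active device of unit power at `x`, normalized by the
mean received power of the intended link and by the decoding threshold. -/
noncomputable def normalizedPathGain (x : Plane) : ℝ≥0∞ :=
  ENNReal.ofReal (p.threshold n * p.R₀ ^ p.η / p.wt) * ‖x‖ₑ ^ (-p.η)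

/-- The probability that a link survives the interference from a device of type `v` at `x`,
as a function of the pair `(x, v)`. -/
noncomputable def survival (z : Plane × Fin V) : ℝ≥0∞ :=
  ENNReal.ofReal (p.κ z.2) * (1 + ENNReal.ofReal (p.w z.2) * p.normalizedPathGain n z.1)⁻¹ +
    ENNReal.ofReal (1 - p.κ z.2)

/-- Normalized interference from a device at `x` with (type, activity) pair and gain `y`. -/
noncomputable def normalizedInterference (x : Plane) (y : (Fin V × Bool) × ℝ) : ℝ≥0∞ :=
  if y.1.2 = true then
    ENNReal.ofReal y.2 * (ENNReal.ofReal (p.w y.1.1) * p.normalizedPathGain n x) else 0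

@[fun_prop]
lemma measurable_normalizedPathGain : Measurable (p.normalizedPathGain n) := by
  unfold normalizedPathGain
  fun_prop

@[fun_prop]
lemma measurable_survival : Measurable (p.survival n) := by
  have h1 : Measurable p.κ := .of_discrete
  have h2 : Measurable p.w := .of_discrete
  unfold survival
  fun_prop

@[fun_prop]
lemma measurable_normalizedInterference :
    Measurable (Function.uncurry (p.normalizedInterference n)) := by
  have h2 : Measurable p.w := .of_discrete
  unfold normalizedInterference Function.uncurry
  refine Measurable.ite (measurableSet_eq_fun (by fun_prop) measurable_const) (by fun_prop)
    measurable_const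

lemma survival_le_one (z : Plane × Fin V) : p.survival n z ≤ 1 := by
  calc p.survival n z ≤ ENNReal.ofReal (p.κ z.2) * 1 + ENNReal.ofReal (1 - p.κ z.2) := by
        unfold survival
        gcongr
        simp
    _ = 1 := by
        rw [mul_one, ← ENNReal.ofReal_add (p.κ_nonneg _) (by linarith [p.κ_le_one z.2])]
        simp

lemma threshold_pos (hn : 1 ≤ n) : 0 < p.threshold n := by
  have h : 0 < p.rate n / (p.ζ * p.W) := by
    have := p.L_pos
    have := p.Ts_pos
    have := p.ζ_pos
    have := p.W_pos
    have : (0 : ℝ) < n := by exact_mod_cast hn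
    unfold rate
    positivity
  have := Real.one_lt_rpow one_lt_two h
  unfold threshold
  linarith

end Params

namespace Network

variable {V : ℕ} {Ω : Type*} {S : Network V Ω} {p : Params V} {n : ℕ}

/-- Cross-multiplication is legitimate even when the interference is `0` or `∞`, because the
threshold is positive and finite. -/
lemma lt_sir_iff (hn : 1 ≤ n) (ω : Ω) :
    ENNReal.ofReal (p.threshold n) < S.sir p ω ↔
      ∑' i, p.normalizedInterference n (S.x i ω) ((S.mark i ω, S.active i ω), S.g i ω) <
        ENNReal.ofReal (S.h ω) := by
  have hθ := p.threshold_pos n hn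
  have hwt := p.wt_pos
  have hR := p.R₀_pos
  set C := p.threshold n * p.R₀ ^ p.η / p.wt with hC
  set D := p.wt * p.R₀ ^ (-p.η) with hD
  have hD0 : 0 < D := by positivity
  have hCD : p.threshold n = D * C := by
    rw [hC, hD, Real.rpow_neg hR.le]
    field_simp
  have hI : ∑' i, p.normalizedInterference n (S.x i ω) ((S.mark i ω, S.active i ω), S.g i ω) =
      ENNReal.ofReal C * S.interference p ω := by
    rw [interference, ← ENNReal.tsum_mul_left]
    congr 1 with i
    simp only [Params.normalizedInterference, Params.normalizedPathGain]
    split_ifs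
    · rw [ENNReal.ofReal_mul (p.w_pos _).le]
      ring
    · simp
  have hS : ENNReal.ofReal (p.wt * S.h ω * p.R₀ ^ (-p.η)) =
      ENNReal.ofReal D * ENNReal.ofReal (S.h ω) := by
    rw [← ENNReal.ofReal_mul hD0.le, hD]
    ring_nf
  rw [hI, sir, hS, ENNReal.lt_div_iff_mul_lt (.inr ENNReal.ofReal_ne_top)
    (.inr (by simpa using hθ)), hCD,
    ENNReal.ofReal_mul hD0.le, mul_assoc]
  exact ENNReal.mul_lt_mul_iff_right (by simpa using hD0) ENNReal.ofReal_ne_top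

end Network

end IoT

-- Success probability given the marked field, and its Laplace functional.

namespace IoT

/-- Counting measure of a sequence of marked points. -/
noncomputable def markedField {E M : Type*} [MeasurableSpace E] [MeasurableSpace M]
    (x : ℕ → E) (m : ℕ → M) : Measure (E × M) :=
  Measure.sum fun i => Measure.dirac (x i, m i)

lemma measurable_markedField {E M : Type*} [MeasurableSpace E] [MeasurableSpace M] :
    Measurable (Function.uncurry (markedField (E := E) (M := M))) := by
  refine Measure.measurable_of_measurable_coe _ fun s hs => ?_
  simp only [markedField, Function.uncurry_def, Measure.sum_apply _ hs, Measure.dirac_apply' _ hs]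
  refine Measurable.tsum fun i => ?_
  exact (measurable_one.indicator hs).comp (by fun_prop)

lemma lintegral_sum_dirac {E : Type*} [MeasurableSpace E] {f : E → ℝ≥0∞} (hf : Measurable f)
    (x : ℕ → E) : ∫⁻ z, f z ∂(Measure.sum fun i => Measure.dirac (x i)) = ∑' i, f (x i) := by
  simp [lintegral_sum_measure, lintegral_dirac' _ hf]

namespace Network.IsHPF

variable {V : ℕ} {Ω : Type*} [MeasurableSpace Ω] {P : Measure Ω} [IsProbabilityMeasure P]
  {S : Network V Ω} {p : Params V} {n : ℕ}

omit [IsProbabilityMeasure P] in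
lemma lintegral_mark_active (hS : S.IsHPF P p) (i : ℕ) (ψ : Fin V → Bool → ℝ≥0∞) :
    ∫⁻ ω, ψ (S.mark i ω) (S.active i ω) ∂P =
      ∑ v, p.f v * (ENNReal.ofReal (p.κ v) * ψ v true + ENNReal.ofReal (1 - p.κ v) * ψ v false) := by
  have hm : Measurable fun ω => (S.mark i ω, S.active i ω) :=
    (hS.measurable_mark i).prodMk (hS.measurable_active i)
  have h1 (v : Fin V) : P.map (fun ω => (S.mark i ω, S.active i ω)) {(v, true)} =
      p.f v * ENNReal.ofReal (p.κ v) := by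
    rw [Measure.map_apply hm (measurableSet_singleton _), ← hS.active_law i v]
    congr 1
    ext ω
    simp
  have h2 (v : Fin V) : P.map (fun ω => (S.mark i ω, S.active i ω)) {(v, false)} =
      p.f v * ENNReal.ofReal (1 - p.κ v) := by
    -- Only the active mass is prescribed; the inactive mass is what remains of the type
    -- probability.
    have hadd : P {ω | S.mark i ω = v ∧ S.active i ω = true} +
        P {ω | S.mark i ω = v ∧ S.active i ω = false} = P {ω | S.mark i ω = v} := by
      have hd : Disjoint {ω | S.mark i ω = v ∧ S.active i ω = true}
          {ω | S.mark i ω = v ∧ S.active i ω = false} :=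
        disjoint_left.2 fun ω h h' => by simp [h.2] at h'
      have hmeas : MeasurableSet {ω | S.mark i ω = v ∧ S.active i ω = false} := by
        convert hm (measurableSet_singleton (v, false)) using 1
        ext ω
        simp
      rw [← measure_union hd hmeas]
      congr 1
      ext ω
      cases h : S.active i ω <;> simp [h]
    rw [Measure.map_apply hm (measurableSet_singleton _)]
    have h3 : (fun ω => (S.mark i ω, S.active i ω)) ⁻¹' {(v, false)} =
        {ω | S.mark i ω = v ∧ S.active i ω = false} := by
      ext ω
      simp
    have hf : p.f v ≠ ∞ := p.f.apply_ne_top v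
    rw [hS.active_law, hS.mark_law] at hadd
    rw [h3, ENNReal.ofReal_sub _ (p.κ_nonneg v), ENNReal.ofReal_one,
      ENNReal.mul_sub (fun _ _ => hf), mul_one]
    exact ENNReal.eq_sub_of_add_eq (ENNReal.mul_ne_top hf ENNReal.ofReal_ne_top)
      (by rw [add_comm, hadd])
  have h0 : ∫⁻ ω, ψ (S.mark i ω) (S.active i ω) ∂P =
      ∫⁻ y, ψ y.1 y.2 ∂(P.map fun ω => (S.mark i ω, S.active i ω)) := by
    rw [lintegral_map (f := fun y : Fin V × Bool => ψ y.1 y.2) .of_discrete hm]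
  rw [h0, lintegral_fintype, Fintype.sum_prod_type]
  refine Finset.sum_congr rfl fun v _ => ?_
  rw [Fintype.sum_bool, h1, h2]
  ring

omit [IsProbabilityMeasure P] in
lemma lintegral_mark (hS : S.IsHPF P p) (i : ℕ) (u : Fin V → ℝ≥0∞) :
    ∫⁻ ω, u (S.mark i ω) ∂P = ∑ v, p.f v * u v := by
  rw [hS.lintegral_mark_active i fun v _ => u v]
  refine Finset.sum_congr rfl fun v _ => ?_
  rw [← add_mul, ← ENNReal.ofReal_add (p.κ_nonneg v) (by linarith [p.κ_le_one v])]
  simp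

/-- Averaging over the activity and the gain of one device, given its type. -/
lemma lintegral_mul_negExp_normalizedInterference (hS : S.IsHPF P p) (x : Plane) (i : ℕ)
    (u : Fin V → ℝ≥0∞) :
    ∫⁻ ω, u (S.mark i ω) *
        negExp (p.normalizedInterference n x ((S.mark i ω, S.active i ω), S.g i ω)) ∂P =
      ∫⁻ ω, u (S.mark i ω) * p.survival n (x, S.mark i ω) ∂P := by
  have hu : Measurable u := .of_discrete
  have hJ : Measurable (p.normalizedInterference n x) := by fun_prop
  have hm : Measurable fun ω => (S.mark i ω, S.active i ω) :=
    (hS.measurable_mark i).prodMk (hS.measurable_active i)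
  have h1 := lintegral_indepFun (hS.indep_gain i) hm (hS.measurable_g i)
    (F := fun y g => u y.1 * negExp (p.normalizedInterference n x (y, g)))
    (by unfold Function.uncurry; fun_prop)
  have h2 (y : Fin V × Bool) :
      ∫⁻ ω, u y.1 * negExp (p.normalizedInterference n x (y, S.g i ω)) ∂P =
        u y.1 * if y.2 = true then
          (1 + ENNReal.ofReal (p.w y.1) * p.normalizedPathGain n x)⁻¹ else 1 := by
    have hg := hS.measurable_g i
    rw [lintegral_const_mul _ (by fun_prop)]
    congr 1
    by_cases hy : y.2 = true
    · simp only [Params.normalizedInterference, hy, if_true]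
      rw [← lintegral_negExp_mul_expMeasure, ← hS.g_law i, lintegral_map (by fun_prop) hg]
    · simp [Params.normalizedInterference, hy]
  refine h1.trans ((lintegral_congr fun ω => h2 (S.mark i ω, S.active i ω)).trans ?_)
  rw [hS.lintegral_mark_active i fun v b => u v * if b = true then
      (1 + ENNReal.ofReal (p.w v) * p.normalizedPathGain n x)⁻¹ else 1,
    hS.lintegral_mark i fun v => u v * p.survival n (x, v)]
  refine Finset.sum_congr rfl fun v _ => ?_
  simp only [Params.survival, if_true, Bool.false_eq_true, if_false]
  ring

omit [IsProbabilityMeasure P] in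
lemma measurable_field (hS : S.IsHPF P p) : Measurable S.field := by
  have h1 := hS.measurable_x
  have h2 := hS.measurable_mark
  exact measurable_markedField.comp
    (f := fun ω => ((fun i => S.x i ω), fun i => S.mark i ω)) (by fun_prop)

omit [IsProbabilityMeasure P] in
lemma measurable_sir (hS : S.IsHPF P p) : Measurable (S.sir p) := by
  have h1 := hS.measurable_x
  have h2 := hS.measurable_mark
  have h3 := hS.measurable_active
  have h4 := hS.measurable_g
  have h5 := hS.measurable_h
  have hw : Measurable p.w := .of_discrete
  have hI : Measurable (S.interference p) := by
    refine Measurable.tsum fun i => ?_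
    exact Measurable.ite (measurableSet_eq_fun (h3 i) measurable_const) (by fun_prop)
      measurable_const
  unfold sir
  fun_prop

/-- Averaging over the activities and the gains of the devices, given their types. -/
lemma lintegral_mul_negExp_tsum_normalizedInterference (hS : S.IsHPF P p) (x : ℕ → Plane)
    {G : (ℕ → Fin V) → ℝ≥0∞} (hG : Measurable G) (hG1 : ∀ m, G m ≤ 1) :
    ∫⁻ ω, G (fun i => S.mark i ω) * negExp (∑' i, p.normalizedInterference n (x i)
        ((S.mark i ω, S.active i ω), S.g i ω)) ∂P =
      ∫⁻ ω, G (fun i => S.mark i ω) *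
        negExp (∑' i, negLog (p.survival n (x i, S.mark i ω))) ∂P := by
  have hmark := hS.measurable_mark
  have hact := hS.measurable_active
  have hg := hS.measurable_g
  refine lintegral_replace_negExp_tsum
    (Z := fun i ω => ((S.mark i ω, S.active i ω), S.g i ω)) (m := fun y => y.1.1)
    (a := fun i => p.normalizedInterference n (x i))
    (b := fun i v => negLog (p.survival n (x i, v))) hS.indep_devices (fun i => by fun_prop)
    (by fun_prop) (fun i => by fun_prop) (fun i => by fun_prop) (fun i u _ => ?_) hG hG1
  simp only [negExp_negLog (p.survival_le_one n _)]
  exact hS.lintegral_mul_negExp_normalizedInterference (x i) i u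

/-- Conditional probability of success given the marked field, integrated over an event that
depends on the marked field only. -/
lemma lintegral_indicator_lt_sir (hS : S.IsHPF P p) (hn : 1 ≤ n)
    {B : Set (Measure (Plane × Fin V))} (hB : MeasurableSet B) :
    P (S.field ⁻¹' B ∩ {ω | ENNReal.ofReal (p.threshold n) < S.sir p ω}) =
      ∫⁻ ω in S.field ⁻¹' B, negExp (∫⁻ z, negLog (p.survival n z) ∂(S.field ω)) ∂P := by
  classical
  have hx := hS.measurable_x
  have hmark := hS.measurable_mark
  have hact := hS.measurable_active
  have hg := hS.measurable_g
  have hh := hS.measurable_h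
  let X (ω : Ω) (i : ℕ) : Plane := S.x i ω
  let Y (ω : Ω) (i : ℕ) : (Fin V × Bool) × ℝ := ((S.mark i ω, S.active i ω), S.g i ω)
  let G (x : ℕ → Plane) (m : ℕ → Fin V) : ℝ≥0∞ := B.indicator 1 (markedField x m)
  let I (x : ℕ → Plane) (y : ℕ → (Fin V × Bool) × ℝ) : ℝ≥0∞ :=
    ∑' i, p.normalizedInterference n (x i) (y i)
  let b (x : ℕ → Plane) (m : ℕ → Fin V) : ℝ≥0∞ := ∑' i, negLog (p.survival n (x i, m i))
  let K (t : ℝ≥0∞) (h : ℝ) : ℝ≥0∞ := {h | t < ENNReal.ofReal h}.indicator 1 h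
  have hX : Measurable X := by fun_prop
  have hY : Measurable Y := by fun_prop
  have hG : Measurable (Function.uncurry G) :=
    (measurable_one.indicator hB).comp measurable_markedField
  have hI : Measurable (Function.uncurry I) := by
    unfold I Function.uncurry
    refine Measurable.tsum fun i => ?_
    fun_prop
  have hb : Measurable (Function.uncurry b) := by
    unfold b Function.uncurry
    refine Measurable.tsum fun i => ?_
    fun_prop
  have hK : Measurable (Function.uncurry K) :=
    measurable_one.indicator (measurableSet_lt measurable_fst (by fun_prop))
  -- With locations frozen, first the gain of the intended link is integrated out, then (`hdev`) the
  -- activities and gains of the devices.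
  have hgain (x : ℕ → Plane) :
      ∫⁻ ω, G x (fun i => (Y ω i).1.1) * K (I x (Y ω)) (S.h ω) ∂P =
        ∫⁻ ω, G x (fun i => (Y ω i).1.1) * negExp (I x (Y ω)) ∂P := by
    rw [lintegral_indepFun hS.indep_h.symm hY hh
      (F := fun y h => G x (fun i => (y i).1.1) * K (I x y) h)
      (by unfold Function.uncurry; fun_prop)]
    refine lintegral_congr fun ω => ?_
    rw [lintegral_const_mul _ (by fun_prop)]
    congr 1
    rw [← expMeasure_one_setOf_lt_ofReal, ← hS.h_law,
      Measure.map_apply hh (measurableSet_lt measurable_const (by fun_prop)),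
      ← lintegral_indicator_one (hh (measurableSet_lt measurable_const (by fun_prop)))]
    rfl
  have hdev (x : ℕ → Plane) :
      ∫⁻ ω, G x (fun i => (Y ω i).1.1) * negExp (I x (Y ω)) ∂P =
        ∫⁻ ω, G x (fun i => (Y ω i).1.1) * negExp (b x fun i => (Y ω i).1.1) ∂P := by
    exact hS.lintegral_mul_negExp_tsum_normalizedInterference x (G := G x) (by fun_prop)
      fun m => indicator_le_self' (fun _ _ => zero_le) _
  have h1 := lintegral_indepFun hS.indep_x hX (by fun_prop)
    (F := fun x (z : ℝ × (ℕ → (Fin V × Bool) × ℝ)) =>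
      G x (fun i => (z.2 i).1.1) * K (I x z.2) z.1) (by unfold Function.uncurry; fun_prop)
  have h2 := lintegral_indepFun hS.indep_x hX (by fun_prop)
    -- The factor `G` carries the event `B`, which involves the locations as well as the types, so
    -- it stays inside both freezing steps `h1` and `h2`.
    (F := fun x (z : ℝ × (ℕ → (Fin V × Bool) × ℝ)) =>
      G x (fun i => (z.2 i).1.1) * negExp (b x fun i => (z.2 i).1.1))
    (by unfold Function.uncurry; fun_prop)
  have hA : MeasurableSet {ω | ENNReal.ofReal (p.threshold n) < S.sir p ω} :=
    measurableSet_lt measurable_const hS.measurable_sir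
  have hBm : MeasurableSet (S.field ⁻¹' B) := hS.measurable_field hB
  calc P (S.field ⁻¹' B ∩ {ω | ENNReal.ofReal (p.threshold n) < S.sir p ω})
      = ∫⁻ ω, G (X ω) (fun i => (Y ω i).1.1) * K (I (X ω) (Y ω)) (S.h ω) ∂P := by
        rw [← lintegral_indicator_one (hBm.inter hA)]
        refine lintegral_congr fun ω => ?_
        have hiff := lt_sir_iff (S := S) (p := p) hn ω
        have hG' : G (X ω) (fun i => (Y ω i).1.1) = (S.field ⁻¹' B).indicator 1 ω := rfl
        have hK' : K (I (X ω) (Y ω)) (S.h ω) =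
            {ω | ENNReal.ofReal (p.threshold n) < S.sir p ω}.indicator 1 ω := by
          simp only [K, indicator_apply, mem_ofPred_eq, hiff, Pi.one_apply]
          rfl
        rw [hG', hK', inter_indicator_one]
        rfl
    _ = ∫⁻ ω, ∫⁻ ω', G (X ω) (fun i => (Y ω' i).1.1) * negExp (b (X ω) fun i => (Y ω' i).1.1)
          ∂P ∂P := h1.trans (lintegral_congr fun ω => (hgain (X ω)).trans (hdev (X ω)))
    _ = ∫⁻ ω, G (X ω) (fun i => (Y ω i).1.1) * negExp (b (X ω) fun i => (Y ω i).1.1) ∂P := h2.symm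
    _ = _ := by
        rw [← lintegral_indicator hBm]
        refine lintegral_congr fun ω => ?_
        have hG' : G (X ω) (fun i => (Y ω i).1.1) = (S.field ⁻¹' B).indicator 1 ω := rfl
        have hb' : b (X ω) (fun i => (Y ω i).1.1) =
            ∫⁻ z, negLog (p.survival n z) ∂(S.field ω) :=
          (lintegral_sum_dirac (f := fun z => negLog (p.survival n z)) (by fun_prop) _).symm
        rw [hG', hb']
        by_cases h : ω ∈ S.field ⁻¹' B <;> simp [h]

/-- The success probability given the marked field is a product over the devices. -/
lemma tsp_ae_eq (hS : S.IsHPF P p) (hn : 1 ≤ n) :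
    S.tsp P p n =ᵐ[P]
      fun ω => (negExp (∫⁻ z, negLog (p.survival n z) ∂(S.field ω))).toReal := by
  have hle : MeasurableSpace.comap S.field inferInstance ≤ (inferInstance : MeasurableSpace Ω) :=
    hS.measurable_field.comap_le
  have hA : MeasurableSet {ω | ENNReal.ofReal (p.threshold n) < S.sir p ω} :=
    measurableSet_lt measurable_const hS.measurable_sir
  have hF : Measurable fun M : Measure (Plane × Fin V) =>
      (negExp (∫⁻ z, negLog (p.survival n z) ∂M)).toReal :=
    (measurable_negExp.comp (Measure.measurable_lintegral (by fun_prop))).ennreal_toReal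
  have hint : Integrable
      (fun ω => (negExp (∫⁻ z, negLog (p.survival n z) ∂(S.field ω))).toReal) P := by
    refine Integrable.of_bound (hF.comp hS.measurable_field).aestronglyMeasurable 1
      (.of_forall fun ω => ?_)
    rw [Real.norm_of_nonneg ENNReal.toReal_nonneg]
    exact ENNReal.toReal_le_of_le_ofReal zero_le_one (by simpa using negExp_le_one _)
  -- The candidate is a function of the field, so it suffices to match integrals over the events
  -- `S.field ⁻¹' B`.
  refine (ae_eq_condExp_of_forall_setIntegral_eq hle ((integrable_const (1 : ℝ)).indicator hA)
    (fun s _ _ => hint.integrableOn) ?_ ?_).symm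
  · rintro _ ⟨B, hB, rfl⟩ -
    have hBm : MeasurableSet (S.field ⁻¹' B) := hS.measurable_field hB
    rw [setIntegral_indicator hA, setIntegral_const, smul_eq_mul, mul_one, measureReal_def,
      hS.lintegral_indicator_lt_sir hn hB, integral_toReal]
    · exact (measurable_negExp.comp ((Measure.measurable_lintegral (by fun_prop)).comp
        hS.measurable_field)).aemeasurable
    · exact .of_forall fun ω => (negExp_ne_top _).lt_top
  · exact (hF.comp (comap_measurable S.field)).aestronglyMeasurable

/-- Laplace functional of the marked field. -/
lemma lintegral_negExp_field (hS : S.IsHPF P p) {φ : Plane × Fin V → ℝ≥0∞} (hφ : Measurable φ) :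
    ∫⁻ ω, negExp (∫⁻ z, φ z ∂(S.field ω)) ∂P =
      negExp (ENNReal.ofReal p.lam *
        ∫⁻ x : Plane, (1 - ∑ v, p.f v * negExp (φ (x, v)))) := by
  have hx := hS.measurable_x
  have hmark := hS.measurable_mark
  have hact := hS.measurable_active
  have hg := hS.measurable_g
  have hh := hS.measurable_h
  let X (ω : Ω) (i : ℕ) : Plane := S.x i ω
  have hX : Measurable X := by fun_prop
  let q (x : Plane) : ℝ≥0∞ := ∑ v, p.f v * negExp (φ (x, v))
  have hq : Measurable q := by fun_prop
  have hq1 (x : Plane) : q x ≤ 1 := by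
    calc q x ≤ ∑ v, p.f v * 1 := by
          unfold q
          gcongr
          exact negExp_le_one _
      _ = 1 := by
          simp only [mul_one]
          rw [← tsum_fintype (L := .unconditional _), p.f.tsum_coe]
  have hmarks (x : ℕ → Plane) :
      ∫⁻ ω, negExp (∑' i, φ (x i, S.mark i ω)) ∂P = negExp (∑' i, negLog (q (x i))) := by
    -- Taking `m` constant keeps no information about the devices, so the types are averaged out
    -- completely and each factor becomes `q (x i)`.
    have h := lintegral_replace_negExp_tsum hS.indep_devices (fun i => by fun_prop)
      (m := fun _ => ()) measurable_const (a := fun i y => φ (x i, y.1.1))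
      (b := fun i _ => negLog (q (x i))) (fun i => by fun_prop) (fun i => measurable_const)
      (fun i u _ => ?_) (G := fun _ => 1) measurable_const fun _ => le_rfl
    · simpa using h
    · rw [lintegral_const_mul _ (by fun_prop), lintegral_const_mul _ measurable_const,
        negExp_negLog (hq1 _), hS.lintegral_mark i fun v => negExp (φ (x i, v))]
      simp [q]
  have h1 := lintegral_indepFun hS.indep_x hX (by fun_prop)
    (F := fun x (z : ℝ × (ℕ → (Fin V × Bool) × ℝ)) => negExp (∑' i, φ (x i, (z.2 i).1.1)))
    (measurable_negExp.comp (Measurable.tsum fun i => hφ.comp (by fun_prop)))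
  have : SigmaFinite (ENNReal.ofReal p.lam • (volume : Measure Plane)) :=
    inferInstanceAs (SigmaFinite (p.lam.toNNReal • (volume : Measure Plane)))
  calc ∫⁻ ω, negExp (∫⁻ z, φ z ∂(S.field ω)) ∂P
      = ∫⁻ ω, negExp (∑' i, φ (S.x i ω, S.mark i ω)) ∂P :=
        lintegral_congr fun ω => congrArg negExp (lintegral_sum_dirac hφ _)
    _ = ∫⁻ ω, negExp (∑' i, negLog (q (X ω i))) ∂P :=
        h1.trans (lintegral_congr fun ω => hmarks (X ω))
    _ = ∫⁻ ω, negExp (∫⁻ x, negLog (q x) ∂(S.locations ω)) ∂P :=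
        lintegral_congr fun ω => congrArg negExp
          (lintegral_sum_dirac (f := fun x => negLog (q x)) (by fun_prop) _).symm
    _ = _ := by
        rw [hS.poisson.lintegral_negExp_lintegral (by fun_prop), lintegral_smul_measure]
        simp only [negExp_negLog (hq1 _), smul_eq_mul]
        rfl

end Network.IsHPF

end IoT

-- Closed forms of the two moments.

namespace IoT

namespace Params

variable {V : ℕ} (p : Params V) (n : ℕ)

/-- The value of `‖x‖ ^ η` at which an active device of type `v` at `x` halves the success
probability. -/
noncomputable def halfGain (v : Fin V) : ℝ := p.w v / p.wt * p.threshold n * p.R₀ ^ p.η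

lemma halfGain_pos (hn : 1 ≤ n) (v : Fin V) : 0 < p.halfGain n v := by
  have := p.threshold_pos n hn
  have := p.w_pos v
  have := p.wt_pos
  have := p.R₀_pos
  unfold halfGain
  positivity

/-- The power `2 / η` turns `R₀ ^ η` into the `R₀ ^ 2` of `Upsilon` and separates threshold from
power ratio. -/
lemma halfGain_rpow (hn : 1 ≤ n) (v : Fin V) :
    2 * Real.pi ^ 2 / (p.η * Real.sin (2 * Real.pi / p.η)) * p.halfGain n v ^ (2 / p.η) =
      p.Upsilon * p.threshold n ^ (2 / p.η) * (p.w v / p.wt) ^ (2 / p.η) := by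
  have hθ := p.threshold_pos n hn
  have := p.w_pos v
  have := p.wt_pos
  have hR := p.R₀_pos
  have hη : p.η ≠ 0 := by linarith [p.two_lt_η]
  have hRη : (p.R₀ ^ p.η) ^ (2 / p.η) = p.R₀ ^ 2 := by
    rw [← Real.rpow_mul hR.le, mul_div_cancel₀ _ hη, Real.rpow_two]
  rw [halfGain, Real.mul_rpow (by positivity) (by positivity),
    Real.mul_rpow (by positivity) hθ.le, hRη, Upsilon]
  ring

lemma Upsilon_pos : 0 < p.Upsilon := by
  have hη := p.two_lt_η
  have hη0 : 0 < p.η := by linarith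
  have hR := p.R₀_pos
  have hpi := Real.pi_pos
  have hsin : 0 < Real.sin (2 * Real.pi / p.η) := by
    refine Real.sin_pos_of_pos_of_lt_pi (by positivity) ?_
    rw [div_lt_iff₀ hη0]
    nlinarith
  unfold Upsilon
  positivity

lemma survival_eq (hn : 1 ≤ n) {x : Plane} (hx : x ≠ 0) (v : Fin V) :
    p.survival n (x, v) =
      ENNReal.ofReal (1 - p.κ v * (p.halfGain n v / (‖x‖ ^ p.η + p.halfGain n v))) := by
  have hc := p.halfGain_pos n hn v
  have hθ := p.threshold_pos n hn
  have hw := p.w_pos v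
  have hwt := p.wt_pos
  have hR := p.R₀_pos
  have hκ := p.κ_nonneg v
  have hκ1 := p.κ_le_one v
  have hx0 : 0 < ‖x‖ := norm_pos_iff.2 hx
  have hxη : 0 < ‖x‖ ^ p.η := by positivity
  have h1 : 1 + ENNReal.ofReal (p.w v) * p.normalizedPathGain n x =
      ENNReal.ofReal (1 + p.halfGain n v / ‖x‖ ^ p.η) := by
    rw [normalizedPathGain, ← ofReal_norm, ENNReal.ofReal_rpow_of_pos hx0,
      ← ENNReal.ofReal_mul (by positivity), ← ENNReal.ofReal_mul hw.le,
      ENNReal.ofReal_add zero_le_one (by positivity), ENNReal.ofReal_one, Real.rpow_neg hx0.le,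
      halfGain]
    congr 2
    field_simp
  simp only [survival]
  rw [h1, ← ENNReal.ofReal_inv_of_pos (by positivity), ← ENNReal.ofReal_mul hκ,
    ← ENNReal.ofReal_add (by positivity) (by linarith)]
  congr 1
  field_simp
  ring

end Params

namespace Network.IsHPF

variable {V : ℕ} {Ω : Type*} [MeasurableSpace Ω] {P : Measure Ω} [IsProbabilityMeasure P]
  {S : Network V Ω} {p : Params V} {n : ℕ}

/-- Since the type probabilities sum to one, `1 - ∑ f (1 - r) = ∑ f r`: each type contributes as a
thinned process of intensity `λ_v`. The origin may be ignored, being a null set. -/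
lemma lintegral_negExp_field_eq_exp (hS : S.IsHPF P p) {φ : Plane × Fin V → ℝ≥0∞}
    (hφ : Measurable φ) {r : Fin V → Plane → ℝ} (hr0 : ∀ v x, 0 ≤ r v x) (hr1 : ∀ v x, r v x ≤ 1)
    (hr : ∀ v, Integrable (r v))
    (h : ∀ x ≠ 0, ∀ v, negExp (φ (x, v)) = ENNReal.ofReal (1 - r v x)) :
    ∫⁻ ω, negExp (∫⁻ z, φ z ∂(S.field ω)) ∂P =
      ENNReal.ofReal (Real.exp (-∑ v, p.intensity v * ∫ x, r v x)) := by
  have hf (v : Fin V) : p.f v = ENNReal.ofReal (p.f v).toReal :=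
    (ENNReal.ofReal_toReal (p.f.apply_ne_top v)).symm
  have hfsum : ∑ v, (p.f v).toReal = 1 := by
    rw [← ENNReal.toReal_sum fun v _ => p.f.apply_ne_top v,
      ← tsum_fintype (L := .unconditional _), p.f.tsum_coe, ENNReal.toReal_one]
  have hcongr : ∀ᵐ x : Plane, 1 - ∑ v, p.f v * negExp (φ (x, v)) =
      ENNReal.ofReal (∑ v, (p.f v).toReal * r v x) := by
    filter_upwards [(measure_eq_zero_iff_ae_notMem).1 (measure_singleton (μ := volume) (0 : Plane))]
      with x hx
    have hsum : ∑ v, p.f v * negExp (φ (x, v)) =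
        ENNReal.ofReal (1 - ∑ v, (p.f v).toReal * r v x) := by
      rw [← hfsum, ← Finset.sum_sub_distrib, ENNReal.ofReal_sum_of_nonneg]
      · refine Finset.sum_congr rfl fun v _ => ?_
        rw [h x hx, ← mul_one_sub, ENNReal.ofReal_mul ENNReal.toReal_nonneg, ← hf]
      · intro v _
        rw [← mul_one_sub]
        exact mul_nonneg ENNReal.toReal_nonneg (sub_nonneg.2 (hr1 v x))
    have hle : ∑ v, (p.f v).toReal * r v x ≤ 1 := by
      rw [← hfsum]
      exact Finset.sum_le_sum fun v _ => mul_le_of_le_one_right ENNReal.toReal_nonneg (hr1 v x)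
    rw [hsum, ← ENNReal.ofReal_one, ← ENNReal.ofReal_sub _ (sub_nonneg.2 hle), sub_sub_cancel]
  have hint : Integrable fun x => ∑ v, (p.f v).toReal * r v x :=
    integrable_finsetSum _ fun v _ => (hr v).const_mul _
  have hnn (x : Plane) : 0 ≤ ∑ v, (p.f v).toReal * r v x :=
    Finset.sum_nonneg fun v _ => mul_nonneg ENNReal.toReal_nonneg (hr0 v x)
  rw [hS.lintegral_negExp_field hφ, lintegral_congr_ae hcongr,
    ← ofReal_integral_eq_lintegral_ofReal hint (.of_forall hnn),
    ← ENNReal.ofReal_mul p.lam_pos.le,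
    negExp_ofReal (mul_nonneg p.lam_pos.le (integral_nonneg hnn)),
    integral_finsetSum _ fun v _ => (hr v).const_mul _, Finset.mul_sum]
  simp_rw [integral_const_mul, Params.intensity]
  congr 4
  ext v
  ring

/-- First moment of the transmission success probability. -/
lemma integral_tsp (hS : S.IsHPF P p) (hn : 1 ≤ n) :
    ∫ ω, S.tsp P p n ω ∂P = Real.exp (-(p.Upsilon * p.threshold n ^ (2 / p.η) *
      ∑ v, (p.w v / p.wt) ^ (2 / p.η) * p.κ v * p.intensity v)) := by
  have hm : Measurable fun ω => negExp (∫⁻ z, negLog (p.survival n z) ∂(S.field ω)) :=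
    measurable_negExp.comp ((Measure.measurable_lintegral (by fun_prop)).comp hS.measurable_field)
  have hy (v : Fin V) := integral_plane_div_add (p.halfGain_pos n hn v) p.two_lt_η
  have hy0 (v : Fin V) (x : Plane) :
      0 ≤ p.halfGain n v / (‖x‖ ^ p.η + p.halfGain n v) := by
    have := p.halfGain_pos n hn v
    positivity
  have hy1 (v : Fin V) (x : Plane) :
      p.halfGain n v / (‖x‖ ^ p.η + p.halfGain n v) ≤ 1 := by
    have := p.halfGain_pos n hn v
    exact div_le_one_of_le₀ (by linarith [Real.rpow_nonneg (norm_nonneg x) p.η]) (by positivity)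
  rw [integral_congr_ae (hS.tsp_ae_eq hn), integral_toReal hm.aemeasurable
    (.of_forall fun ω => (negExp_ne_top _).lt_top),
    hS.lintegral_negExp_field_eq_exp (by fun_prop)
      (r := fun v x => p.κ v * (p.halfGain n v / (‖x‖ ^ p.η + p.halfGain n v)))
      (fun v x => mul_nonneg (p.κ_nonneg v) (hy0 v x))
      (fun v x => mul_le_one₀ (p.κ_le_one v) (hy0 v x) (hy1 v x))
      (fun v => (hy v).1.const_mul _)
      (fun x hx v => by rw [negExp_negLog (p.survival_le_one n _), p.survival_eq n hn hx]),
    ENNReal.toReal_ofReal (Real.exp_pos _).le, Finset.mul_sum]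
  congr 3 with v
  rw [integral_const_mul, (hy v).2, p.halfGain_rpow n hn]
  ring

/-- Second moment of the transmission success probability. -/
lemma integral_tsp_sq (hS : S.IsHPF P p) (hn : 1 ≤ n) :
    ∫ ω, S.tsp P p n ω ^ 2 ∂P = Real.exp (-(p.Upsilon * p.threshold n ^ (2 / p.η) *
      ∑ v, (p.w v / p.wt) ^ (2 / p.η) * p.κ v * p.intensity v *
        (2 - (1 - 2 / p.η) * p.κ v))) := by
  have hL : Measurable fun z => negLog (p.survival n z) := by fun_prop
  have hm : Measurable fun ω => negExp (∫⁻ z, (negLog (p.survival n z) +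
      negLog (p.survival n z)) ∂(S.field ω)) :=
    measurable_negExp.comp ((Measure.measurable_lintegral (by fun_prop)).comp hS.measurable_field)
  have hy (v : Fin V) := integral_plane_div_add (p.halfGain_pos n hn v) p.two_lt_η
  have hy2 (v : Fin V) := integral_plane_div_add_sq (p.halfGain_pos n hn v) p.two_lt_η
  have hy0 (v : Fin V) (x : Plane) :
      0 ≤ p.κ v * (p.halfGain n v / (‖x‖ ^ p.η + p.halfGain n v)) := by
    have := p.halfGain_pos n hn v
    have := p.κ_nonneg v
    positivity
  have hy1 (v : Fin V) (x : Plane) :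
      p.κ v * (p.halfGain n v / (‖x‖ ^ p.η + p.halfGain n v)) ≤ 1 := by
    have := p.halfGain_pos n hn v
    exact mul_le_one₀ (p.κ_le_one v) (by positivity) (div_le_one_of_le₀
      (by linarith [Real.rpow_nonneg (norm_nonneg x) p.η]) (by positivity))
  -- Squaring the product doubles the exponent, so the second moment is again a Laplace functional.
  have hsq : (fun ω => S.tsp P p n ω ^ 2) =ᵐ[P] fun ω => (negExp (∫⁻ z,
      (negLog (p.survival n z) + negLog (p.survival n z)) ∂(S.field ω))).toReal := by
    filter_upwards [hS.tsp_ae_eq hn] with ω hω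
    rw [hω, lintegral_add_left hL, negExp_add, ENNReal.toReal_mul, sq]
  rw [integral_congr_ae hsq, integral_toReal hm.aemeasurable
    (.of_forall fun ω => (negExp_ne_top _).lt_top),
    hS.lintegral_negExp_field_eq_exp (by fun_prop)
      -- This is `1 - (1 - κ y)²` expanded.
      (r := fun v x => 2 * p.κ v * (p.halfGain n v / (‖x‖ ^ p.η + p.halfGain n v)) -
        p.κ v ^ 2 * (p.halfGain n v / (‖x‖ ^ p.η + p.halfGain n v)) ^ 2)
      (fun v x => by nlinarith [hy0 v x, hy1 v x])
      (fun v x => by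
        have := sq_nonneg (1 - p.κ v * (p.halfGain n v / (‖x‖ ^ p.η + p.halfGain n v)))
        nlinarith)
      (fun v => ((hy v).1.const_mul _).sub ((hy2 v).1.const_mul _))
      (fun x hx v => by
        rw [negExp_add, negExp_negLog (p.survival_le_one n _), p.survival_eq n hn hx,
          ← ENNReal.ofReal_mul (sub_nonneg.2 (hy1 v x))]
        ring_nf),
    ENNReal.toReal_ofReal (Real.exp_pos _).le, Finset.mul_sum]
  congr 3 with v
  rw [integral_sub ((hy v).1.const_mul _) ((hy2 v).1.const_mul _), integral_const_mul,
    integral_const_mul, (hy v).2, (hy2 v).2, p.halfGain_rpow n hn]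
  ring

lemma tsp_mem_Icc (hS : S.IsHPF P p) (hn : 1 ≤ n) :
    ∀ᵐ ω ∂P, S.tsp P p n ω ∈ Icc (0 : ℝ) 1 := by
  filter_upwards [hS.tsp_ae_eq hn] with ω hω
  rw [hω]
  exact ⟨ENNReal.toReal_nonneg,
    ENNReal.toReal_le_of_le_ofReal zero_le_one (by simpa using negExp_le_one _)⟩

end Network.IsHPF

end IoT

-- Moment inequalities and conclusion.

theorem proposition1 {V : ℕ} (p : IoT.Params V) {Ω : Type*} [MeasurableSpace Ω]
    (P : Measure Ω) [IsProbabilityMeasure P] (S : IoT.Network V Ω) (hS : S.IsHPF P p)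
    (n : ℕ) (hn : 1 ≤ n) :
    let μ : ℝ := ∫ ω, S.tsp P p n ω ∂P
    let ν : ℝ := ∫ ω, S.tsp P p n ω ^ 2 ∂P
    let a : ℝ := μ * (μ - ν) / (ν - μ ^ 2)
    let b : ℝ := (1 - μ) * (μ - ν) / (ν - μ ^ 2)
    -- closed forms of the first two moments of the transmission success probability
    μ = Real.exp (-(p.Upsilon * p.threshold n ^ (2 / p.η) *
          ∑ v, (p.w v / p.wt) ^ (2 / p.η) * p.κ v * p.intensity v)) ∧
    ν = Real.exp (-(p.Upsilon * p.threshold n ^ (2 / p.η) *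
          ∑ v, (p.w v / p.wt) ^ (2 / p.η) * p.κ v * p.intensity v *
            (2 - (1 - 2 / p.η) * p.κ v))) ∧
    -- the approximating beta law, unless almost surely no device is ever active
    ((∃ v, 0 < p.κ v * p.intensity v) →
      0 < a ∧ 0 < b ∧
      -- it is the only beta law with these two moments
      (∀ a' b' : ℝ, 0 < a' → 0 < b' →
        ((∫ t, t ∂(betaMeasure a' b') = μ ∧ ∫ t, t ^ 2 ∂(betaMeasure a' b') = ν) ↔
          (a' = a ∧ b' = b))) ∧
      -- its complementary distribution function is the approximation `1 - I_γ(a, b)`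
      (∀ γ ∈ Icc (0 : ℝ) 1,
        (betaMeasure a b).real (Ioi γ) = 1 - IoT.regIncBeta a b γ) ∧
      -- the meta distribution and its approximation have the same first two moments
      (∫ γ in (0 : ℝ)..1, S.metaDistribution P p n γ) =
        (∫ γ in (0 : ℝ)..1, (1 - IoT.regIncBeta a b γ)) ∧
      (∫ γ in (0 : ℝ)..1, 2 * γ * S.metaDistribution P p n γ) =
        ∫ γ in (0 : ℝ)..1, 2 * γ * (1 - IoT.regIncBeta a b γ)) := by

  intro μ ν a b
  have hμ : μ = _ := hS.integral_tsp hn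
  have hν : ν = _ := hS.integral_tsp_sq hn
  refine ⟨hμ, hν, fun ⟨v₀, hv₀⟩ => ?_⟩
  have hη0 : 0 < p.η := by linarith [p.two_lt_η]
  have hδ0 : 0 < 2 / p.η := by positivity
  have hδ1 : 2 / p.η < 1 := (div_lt_one hη0).2 p.two_lt_η
  have hC : 0 < p.Upsilon * p.threshold n ^ (2 / p.η) :=
    mul_pos p.Upsilon_pos (Real.rpow_pos_of_pos (p.threshold_pos n hn) _)
  have hW (v : Fin V) : 0 < (p.w v / p.wt) ^ (2 / p.η) :=
    Real.rpow_pos_of_pos (div_pos (p.w_pos v) p.wt_pos) _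
  have hterm0 (v : Fin V) : 0 ≤ (p.w v / p.wt) ^ (2 / p.η) * p.κ v * p.intensity v :=
    mul_nonneg (mul_nonneg (hW v).le (p.κ_nonneg v))
      (mul_nonneg ENNReal.toReal_nonneg p.lam_pos.le)
  have hterm : 0 < (p.w v₀ / p.wt) ^ (2 / p.η) * p.κ v₀ * p.intensity v₀ := by
    rw [mul_assoc]
    exact mul_pos (hW v₀) hv₀
  have hκ₀ : 0 < p.κ v₀ := by
    refine lt_of_le_of_ne (p.κ_nonneg v₀) fun h => ?_
    rw [← h, zero_mul] at hv₀
    exact hv₀.false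
  -- Strict because `κ_v ≤ 1` and `0 < 1 - 2 / η < 1`; this gives `ν < μ`.
  have hlt (v : Fin V) : 1 < 2 - (1 - 2 / p.η) * p.κ v := by
    nlinarith [p.κ_le_one v, p.κ_nonneg v]
  have hle (v : Fin V) : 2 - (1 - 2 / p.η) * p.κ v ≤ 2 := by
    nlinarith [p.κ_nonneg v]
  have h1 : ν < μ := by
    rw [hμ, hν, Real.exp_lt_exp, neg_lt_neg_iff]
    refine mul_lt_mul_of_pos_left (Finset.sum_lt_sum (fun v _ => ?_)
      ⟨v₀, Finset.mem_univ _, ?_⟩) hC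
    · exact le_mul_of_one_le_right (hterm0 v) (hlt v).le
    · exact lt_mul_of_one_lt_right hterm (hlt v₀)
  -- Squaring doubles the exponent of `μ`, and the terms of `ν` carry factors at most `2`, strictly
  -- less at `v₀` since `κ_{v₀} > 0`.
  have h2 : μ ^ 2 < ν := by
    rw [hμ, hν, ← Real.exp_nat_mul, Real.exp_lt_exp, Nat.cast_ofNat, mul_neg, neg_lt_neg_iff,
      mul_left_comm, Finset.mul_sum _ _ (2 : ℝ)]
    refine mul_lt_mul_of_pos_left (Finset.sum_lt_sum (fun v _ => ?_)
      ⟨v₀, Finset.mem_univ _, ?_⟩) hC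
    · rw [mul_comm 2]
      exact mul_le_mul_of_nonneg_left (hle v) (hterm0 v)
    · rw [mul_comm 2]
      refine mul_lt_mul_of_pos_left ?_ hterm
      nlinarith
  have hX : AEMeasurable (S.tsp P p n) P :=
    stronglyMeasurable_condExp.measurable.mono hS.measurable_field.comap_le le_rfl |>.aemeasurable
  exact IoT.beta_fit_of_moments hX (hS.tsp_mem_Icc hn) rfl rfl h1 h2 rfl rfl
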